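/- Let $d\ge 1$ and let $\mathbb H_d$ be the $d$-dimensional discrete hypercube graph: its vertex set is $V=\{0,1\}^d$, two vertices are adjacent when they differ in exactly one coordinate, and $d(\cdot,\cdot)$ is the graph distance. For a probability distribution $\mu$ on a finite set write $S(\mu)=\sum_x \mu(x)\ln(1/\mu(x))$ (with $0\ln(1/0)=0$). For probability distributions $\mu_A,\mu_B$ on $V$, a transportation from $\mu_A$ to $\mu_B$ is a function $\tau:V\times V\to\mathbb R_{\ge 0}$ with $\sum_b\tau(a,b)=\mu_A(a)$ for all $a$ and $\sum_a\tau(a,b)=\mu_B(b)$ for all $b$. Put $W^2(\tau)=\sum_{a,b}\tau(a,b)\,d(a,b)^2$ and $W^2(\mu_A,\mu_B)=\inf_\tau W^2(\tau)$ (no square root is taken), the infimum being over all transportations from $\mu_A$ to $\mu_B$; $\tau$ is optimal if it minimizes $W^2(\tau)$. For vertices $a,b$, let $\widetilde m(a,b)$ be the set of vertices $u$ with $2d(u,a)=2d(u,b)=d(a,b)$ if $d(a,b)$ is even, and the set of (unordered) edges $uv$ with $2d(u,a)+1=2d(v,b)+1=d(a,b)$, for some labelling $u,v$ of the ends, if $d(a,b)$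 is odd. The midpoint of a geodesic is its middle vertex if its length is even and its middle edge if its length is odd. Given $\tau$, the distance-interpolation midpoint distribution of $\tau$ is the function $\mu_C$ on the vertices and edges given by $$\mu_C(X)=\sum_{a,b}\tau(a,b)\,\frac{\#\{\text{geodesics from } a \text{ to } b \text{ with midpoint } X\}}{\#\{\text{geodesics from } a \text{ to } b\}} .$$ Theorem. For all probability distributions $\mu_A,\mu_B$ on the vertices of $\mathbb H_d$ there is an optimal transportation $\tau$ from $\mu_A$ to $\mu_B$ whose distance-interpolation midpoint distribution $\mu_C$ is a probability distribution, is supported on $\bigcup\{\widetilde m(a,b):\mu_A(a)>0,\ \mu_B(b)>0\}$, and satisfies $$S(\mu_C)\ \ge\ \tfrac13 S(\mu_A)+\tfrac13 S(\mu_B)+\frac{2}{5d^3}\bigl(W^2(\mu_A,\mu_B)\bigr)^2-\frac23 .$$ -/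

import Mathlib

namespace HypercubeTransport

/-- The `d`-dimensional discrete hypercube: vertices are the `0/1`-vectors of length `d`, and two
of them are adjacent when they differ in exactly one coordinate. -/
def hypercube (d : ℕ) : SimpleGraph (Fin d → Bool) where
  Adj x y := hammingDist x y = 1
  symm := ⟨fun x y h => by rw [hammingDist_comm]; exact h⟩
  loopless := ⟨fun x h => by simp at h⟩

instance (d : ℕ) : DecidableRel (hypercube d).Adj :=
  fun x y => inferInstanceAs (Decidable (hammingDist x y = 1))

/-- Entropy `S(μ) = ∑ μ(x) ln (1 / μ(x))` of a mass function on a finite set. -/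
noncomputable def entropy {X : Type*} [Fintype X] (μ : X → ℝ) : ℝ :=
  ∑ x, Real.negMulLog (μ x)

/-- `τ` is a transportation from `μA` to `μB`. -/
structure IsTransport {V : Type*} [Fintype V] (μA μB : V → ℝ) (τ : V → V → ℝ) : Prop where
  nonneg : ∀ a b, 0 ≤ τ a b
  sum_right : ∀ a, ∑ b, τ a b = μA a
  sum_left : ∀ b, ∑ a, τ a b = μB b

/-- The cost of order two, `W²(τ) = ∑ τ(a,b) d(a,b)²`, for the graph distance `d` (no square root
is taken). -/
noncomputable def cost {V : Type*} [Fintype V] (G : SimpleGraph V) (τ : V → V → ℝ) : ℝ :=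
  ∑ a, ∑ b, τ a b * (G.dist a b : ℝ) ^ 2

/-- `W²(μA, μB)`, the infimum of `W²(τ)` over the transportations from `μA` to `μB`. -/
noncomputable def wasserstein {V : Type*} [Fintype V] (G : SimpleGraph V) (μA μB : V → ℝ) : ℝ :=
  sInf {w : ℝ | ∃ τ : V → V → ℝ, IsTransport μA μB τ ∧ cost G τ = w}

/-- An optimal transportation from `μA` to `μB` is one that minimizes `W²`. -/
def IsOptimal {V : Type*} [Fintype V] (G : SimpleGraph V) (μA μB : V → ℝ)
    (τ : V → V → ℝ) : Prop :=
  IsTransport μA μB τ ∧ ∀ τ' : V → V → ℝ, IsTransport μA μB τ' → cost G τ ≤ cost G τ'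

/-- The midpoints of `a` and `b`: the vertices halfway between them when `d(a,b)` is even, the
edges halfway between them when `d(a,b)` is odd. The equations force the parity. -/
def midpoints {V : Type*} (G : SimpleGraph V) (a b : V) : Set (V ⊕ Sym2 V) :=
  {X | (∃ u, X = Sum.inl u ∧ 2 * G.dist u a = G.dist a b ∧ 2 * G.dist u b = G.dist a b) ∨
    ∃ u v, X = Sum.inr s(u, v) ∧ G.Adj u v ∧
      2 * G.dist u a + 1 = G.dist a b ∧ 2 * G.dist v b + 1 = G.dist a b}

/-- The geodesics from `a` to `b`: the walks of length `d(a,b)`. -/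
noncomputable def geodesics {V : Type*} [Fintype V] [DecidableEq V] (G : SimpleGraph V)
    [DecidableRel G.Adj] (a b : V) : Finset (G.Walk a b) :=
  G.finsetWalkLength (G.dist a b) a b

/-- The middle of a walk: its middle vertex if the length is even, its middle edge if the length
is odd. -/
def middle {V : Type*} {G : SimpleGraph V} {a b : V} (P : G.Walk a b) : V ⊕ Sym2 V :=
  if Even P.length then Sum.inl (P.getVert (P.length / 2))
  else Sum.inr s(P.getVert (P.length / 2), P.getVert (P.length / 2 + 1))

/-- Distance interpolation at time `1/2`: each mass `τ(a,b)` is spread uniformly over the geodesics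
from `a` to `b`, and the mass on a geodesic is placed on its middle. -/
noncomputable def midpointDist {V : Type*} [Fintype V] [DecidableEq V] (G : SimpleGraph V)
    [DecidableRel G.Adj] (τ : V → V → ℝ) (X : V ⊕ Sym2 V) : ℝ :=
  ∑ a, ∑ b, τ a b * ∑ P ∈ geodesics G a b with middle P = X, 1 / ((geodesics G a b).card : ℝ)

end HypercubeTransport

/-! Let (A, B) have law τ and let C be the middle of a uniform geodesic from A to B, kept as an
ordered pair of vertices that coincide for even length. Write H for entropy and W for the cost of τ.
Among the optimal transportations, take one that maximizes H(A,B,C); it exists by compactness.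

Optimality implies that if c is a middle for (a,b) and for (a',b'), both of positive mass, then it
is one for (a,b') (`IsOptimal.isMid_exchange`). Hence making A and B independent given C gives
another optimal transportation, and maximality yields H(A,C) + H(B,C) ≤ H(C) + H(A,B,C)
(`entropy_ends_middle_le`). The reflection exchanging A and B sends C to an opposite middle C'. The
pairs (A,C) and (A,C') have the same law, and A, C, C' determine B, so submodularity gives H(A,B,C)
+ H(A) ≤ 2H(A,C), and similarly for B. Together these say H(A) + H(B) ≤ 2H(C).

Thus F = 3H(C) - H(A) - H(B) is at least H(C), which is at least g = H(C | A,B), the quantity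
`gain`. When W is large a second bound is needed, F ≥ 3g - (d-2) ln 2. It uses H(A,C) ≥ H(A) + g,
its analogue for B, and the fact that a middle has at most 2^(d-2) pairs of ends (`card_ends_le`).
Central binomial estimates give g ≥ (W/d) ln 2 - ½ ln((8d+4)/5), and `gain_numeric` turns the two
bounds on F into the theorem. -/

open Finset

set_option linter.unusedSectionVars false

namespace HypercubeTransport

/-! ### Entropy of finite random variables -/

section Entropy

variable {Ω α β γ : Type*} [Fintype Ω] [Fintype α] [Fintype β] [Fintype γ]
  [DecidableEq α] [DecidableEq β] [DecidableEq γ]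

/-- The law of `X` under the mass function `π`. -/
noncomputable def marginal {Ω α : Type*} [Fintype Ω] [DecidableEq α] (π : Ω → ℝ) (X : Ω → α)
    (y : α) : ℝ :=
  ∑ ω with X ω = y, π ω

lemma marginal_nonneg {π : Ω → ℝ} (hπ : ∀ ω, 0 ≤ π ω) (X : Ω → α) (y : α) :
    0 ≤ marginal π X y :=
  sum_nonneg fun ω _ => hπ ω

lemma le_marginal {π : Ω → ℝ} (hπ : ∀ ω, 0 ≤ π ω) (X : Ω → α) (ω : Ω) :
    π ω ≤ marginal π X (X ω) :=
  single_le_sum (f := π) (fun ω _ => hπ ω) (by simp)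

lemma exists_of_marginal_pos {π : Ω → ℝ} {X : Ω → α} {y : α} (h : 0 < marginal π X y) :
    ∃ ω, X ω = y ∧ 0 < π ω := by
  obtain ⟨ω, h1, h2⟩ := exists_lt_of_sum_lt (f := fun _ => (0 : ℝ)) (by simpa [marginal] using h)
  exact ⟨ω, by simpa using h1, h2⟩

lemma sum_mul_comp (π : Ω → ℝ) (X : Ω → α) (h : α → ℝ) :
    ∑ ω, π ω * h (X ω) = ∑ y, marginal π X y * h y := by
  rw [← sum_fiberwise univ X]
  refine sum_congr rfl fun y _ => ?_
  rw [marginal, sum_mul]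
  refine sum_congr rfl fun ω hω => ?_
  rw [(mem_filter.1 hω).2]

lemma sum_marginal (π : Ω → ℝ) (X : Ω → α) : ∑ y, marginal π X y = ∑ ω, π ω := by
  simpa using (sum_mul_comp π X fun _ => 1).symm

lemma marginal_marginal (π : Ω → ℝ) (X : Ω → α) (f : α → β) :
    marginal (marginal π X) f = marginal π (f ∘ X) := by
  funext z
  have := sum_mul_comp π X fun y => if f y = z then 1 else 0
  simpa [marginal, sum_filter] using this.symm

lemma sum_marginal_fst (π : Ω → ℝ) (X : Ω → α) (Z : Ω → γ) (z : γ) :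
    ∑ x, marginal π (fun ω => (X ω, Z ω)) (x, z) = marginal π Z z := by
  simp only [marginal, Prod.mk.injEq]
  rw [← sum_fiberwise (univ.filter fun ω => Z ω = z) X]
  refine sum_congr rfl fun x _ => ?_
  congr 1
  ext ω
  simp [and_comm]

lemma entropy_marginal (π : Ω → ℝ) (X : Ω → α) :
    entropy (marginal π X) = -∑ ω, π ω * Real.log (marginal π X (X ω)) := by
  rw [sum_mul_comp π X fun y => Real.log (marginal π X y), entropy, ← sum_neg_distrib]
  exact sum_congr rfl fun y _ => by rw [Real.negMulLog, neg_mul]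

lemma entropy_marginal_nonneg {π : Ω → ℝ} (hπ : ∀ ω, 0 ≤ π ω) (h1 : ∑ ω, π ω = 1) (X : Ω → α) :
    0 ≤ entropy (marginal π X) := by
  refine sum_nonneg fun y _ => Real.negMulLog_nonneg (marginal_nonneg hπ X y) ?_
  rw [← h1, ← sum_marginal π X]
  exact single_le_sum (fun y _ => marginal_nonneg hπ X y) (mem_univ y)

/-- Gibbs' inequality, from ln x ≤ x - 1 applied to g/f. Only the mass of g on the support of f
matters, so g may be a subprobability or have further mass elsewhere. -/
lemma entropy_le_cross {f g : Ω → ℝ} (hf : ∀ i, 0 ≤ f i) (hg : ∀ i, 0 < f i → 0 < g i)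
    (hs : ∑ i with 0 < f i, g i ≤ ∑ i, f i) :
    entropy f ≤ -∑ i, f i * Real.log (g i) := by
  have h1 : ∑ i with 0 < f i, f i = ∑ i, f i := by
    rw [sum_filter]
    refine sum_congr rfl fun i _ => ?_
    split_ifs with h
    · rfl
    · exact le_antisymm (hf i) (not_lt.1 h)
  have h2 : entropy f + ∑ i, f i * Real.log (g i) ≤ ∑ i with 0 < f i, (g i - f i) := by
    rw [entropy, ← sum_add_distrib, sum_filter]
    refine sum_le_sum fun i _ => ?_
    split_ifs with h
    · have hgi := hg i h
      have := Real.log_le_sub_one_of_pos (div_pos hgi h)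
      rw [Real.log_div hgi.ne' h.ne'] at this
      have h3 := mul_le_mul_of_nonneg_left this h.le
      rw [mul_sub, mul_sub, mul_div_cancel₀ _ h.ne', mul_one] at h3
      rw [Real.negMulLog]
      linarith
    · rw [le_antisymm (not_lt.1 h) (hf i)]
      simp
  rw [sum_sub_distrib, h1] at h2
  linarith

/-- Gibbs' inequality against the law p(x,z) q(y,z) / s(z), under which X and Y are independent
given Z. Injectivity identifies the entropy of π with the joint entropy of X, Y, Z. -/
lemma submodular {π : Ω → ℝ} (hπ : ∀ ω, 0 ≤ π ω) (X : Ω → α) (Y : Ω → β) (Z : Ω → γ)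
    (hinj : Function.Injective fun ω => (X ω, Y ω, Z ω)) :
    entropy π + entropy (marginal π Z) ≤
      entropy (marginal π fun ω => (X ω, Z ω)) + entropy (marginal π fun ω => (Y ω, Z ω)) := by
  set p := marginal π fun ω => (X ω, Z ω) with hp
  set q := marginal π fun ω => (Y ω, Z ω) with hq
  set s := marginal π Z with hs
  have hp0 : ∀ t, 0 ≤ p t := marginal_nonneg hπ _
  have hq0 : ∀ t, 0 ≤ q t := marginal_nonneg hπ _
  have hs0 : ∀ t, 0 ≤ s t := marginal_nonneg hπ _
  have hp1 : ∀ ω, 0 < π ω → 0 < p (X ω, Z ω) := fun ω h =>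
    h.trans_le (le_marginal hπ (fun ω => (X ω, Z ω)) ω)
  have hq1 : ∀ ω, 0 < π ω → 0 < q (Y ω, Z ω) := fun ω h =>
    h.trans_le (le_marginal hπ (fun ω => (Y ω, Z ω)) ω)
  have hs1 : ∀ ω, 0 < π ω → 0 < s (Z ω) := fun ω h => h.trans_le (le_marginal hπ Z ω)
  have key := entropy_le_cross (f := π) (g := fun ω => p (X ω, Z ω) * q (Y ω, Z ω) / s (Z ω)) hπ
    (fun ω h => div_pos (mul_pos (hp1 ω h) (hq1 ω h)) (hs1 ω h)) (by
      let G : α × β × γ → ℝ := fun t => p (t.1, t.2.2) * q (t.2.1, t.2.2) / s t.2.2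
      have hG : ∀ t, 0 ≤ G t := fun t => div_nonneg (mul_nonneg (hp0 _) (hq0 _)) (hs0 _)
      calc ∑ ω with 0 < π ω, p (X ω, Z ω) * q (Y ω, Z ω) / s (Z ω)
          ≤ ∑ ω, G (X ω, Y ω, Z ω) :=
            sum_le_sum_of_subset_of_nonneg (filter_subset _ _) fun ω _ _ => hG (X ω, Y ω, Z ω)
        _ = ∑ t ∈ univ.image fun ω => (X ω, Y ω, Z ω), G t :=
            (sum_image fun a _ b _ h => hinj h).symm
        _ ≤ ∑ t, G t := sum_le_sum_of_subset_of_nonneg (subset_univ _) fun t _ _ => hG t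
        _ = ∑ z, ∑ x, ∑ y, p (x, z) * q (y, z) / s z := by
            rw [Fintype.sum_prod_type]
            simp_rw [Fintype.sum_prod_type_right]
            rw [sum_comm]
        _ = ∑ z, s z := by
            refine sum_congr rfl fun z _ => ?_
            simp_rw [← sum_div, ← mul_sum, ← sum_mul]
            rw [hp, hq, sum_marginal_fst, sum_marginal_fst, ← hs]
            -- This also covers s(z) = 0, where the quotient is 0 by convention.
            exact mul_self_div_self _
        _ = ∑ ω, π ω := sum_marginal _ _)
  rw [hp, hq, hs, entropy_marginal, entropy_marginal, entropy_marginal, ← hp, ← hq, ← hs]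
  have : ∑ ω, π ω * Real.log (p (X ω, Z ω) * q (Y ω, Z ω) / s (Z ω)) =
      ∑ ω, π ω * Real.log (p (X ω, Z ω)) + ∑ ω, π ω * Real.log (q (Y ω, Z ω))
        - ∑ ω, π ω * Real.log (s (Z ω)) := by
    rw [← sum_add_distrib, ← sum_sub_distrib]
    refine sum_congr rfl fun ω _ => ?_
    rcases (hπ ω).eq_or_lt with h | h
    · simp [← h]
    · rw [Real.log_div (mul_pos (hp1 ω h) (hq1 ω h)).ne' (hs1 ω h).ne',
        Real.log_mul (hp1 ω h).ne' (hq1 ω h).ne']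
      ring
  rw [this] at key
  linarith

lemma entropy_marginal_unit {π : Ω → ℝ} (h1 : ∑ ω, π ω = 1) :
    entropy (marginal π fun _ => ()) = 0 := by
  simp [entropy, marginal, h1]

lemma entropy_marginal_comp {π : Ω → ℝ} (X : Ω → α) {f : α → β}
    (hf : ∀ ω ω', 0 < π ω → 0 < π ω' → f (X ω) = f (X ω') → X ω = X ω') (hπ : ∀ ω, 0 ≤ π ω) :
    entropy (marginal π (f ∘ X)) = entropy (marginal π X) := by
  rw [entropy_marginal, entropy_marginal]
  congr 1
  refine sum_congr rfl fun ω _ => ?_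
  rcases (hπ ω).eq_or_lt with h | h
  · simp [← h]
  congr 2
  simp only [marginal, sum_filter]
  refine sum_congr rfl fun ω' _ => ?_
  rcases (hπ ω').eq_or_lt with h' | h'
  · simp [← h']
  · by_cases hx : X ω' = X ω
    · simp [hx]
    · exact (if_neg fun h0 => hx (hf _ _ h' h h0)).trans (if_neg hx).symm

/-- Given Z there are at most K possible outcomes, so the conditional entropy is at most ln K. The
comparison measure spreads each mass of Z with weight 1/K. -/
lemma entropy_le_add_log_card {π : Ω → ℝ} (hπ : ∀ ω, 0 ≤ π ω) (h1 : ∑ ω, π ω = 1) (Z : Ω → γ)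
    {K : ℝ} (hK : 0 < K) (hc : ∀ z, (#{ω | 0 < π ω ∧ Z ω = z} : ℝ) ≤ K) :
    entropy π ≤ entropy (marginal π Z) + Real.log K := by
  have hs1 : ∀ ω, 0 < π ω → 0 < marginal π Z (Z ω) := fun ω h => h.trans_le (le_marginal hπ Z ω)
  have key := entropy_le_cross (f := π) (g := fun ω => marginal π Z (Z ω) / K) hπ
    (fun ω h => div_pos (hs1 ω h) hK) (by
      rw [← sum_marginal π Z, ← sum_fiberwise _ Z]
      refine sum_le_sum fun z _ => ?_
      rw [sum_congr rfl (g := fun _ => marginal π Z z / K)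
        (fun ω hω => by rw [(mem_filter.1 hω).2]), sum_const, nsmul_eq_mul, filter_filter,
        mul_div_assoc', div_le_iff₀ hK, mul_comm]
      exact mul_le_mul_of_nonneg_left (hc z) (marginal_nonneg hπ Z z))
  have : ∑ ω, π ω * Real.log (marginal π Z (Z ω) / K) =
      ∑ ω, π ω * Real.log (marginal π Z (Z ω)) - Real.log K := by
    rw [← one_mul (Real.log K), ← h1, sum_mul, ← sum_sub_distrib]
    refine sum_congr rfl fun ω _ => ?_
    rcases (hπ ω).eq_or_lt with h | h
    · simp [← h]
    · rw [Real.log_div (hs1 ω h).ne' hK.ne']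
      ring
  rw [this] at key
  rw [entropy_marginal]
  linarith

/-- The law of `((a, b), c)` with the same laws of `(a, c)` and of `(b, c)` as under `π`, for which
`a` and `b` are independent given `c`. -/
noncomputable def condProd (π : (α × β) × γ → ℝ) (ω : (α × β) × γ) : ℝ :=
  marginal π (fun ω => (ω.1.1, ω.2)) (ω.1.1, ω.2) *
    marginal π (fun ω => (ω.1.2, ω.2)) (ω.1.2, ω.2) / marginal π (fun ω => ω.2) ω.2

lemma condProd_nonneg {π : (α × β) × γ → ℝ} (hπ : ∀ ω, 0 ≤ π ω) (ω : (α × β) × γ) :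
    0 ≤ condProd π ω :=
  div_nonneg (mul_nonneg (marginal_nonneg hπ _ _) (marginal_nonneg hπ _ _))
    (marginal_nonneg hπ _ _)

lemma marginal_fst_eq (π : (α × β) × γ → ℝ) (a : α) (c : γ) :
    marginal π (fun ω => (ω.1.1, ω.2)) (a, c) = ∑ b, π ((a, b), c) := by
  simp only [marginal, sum_filter, Fintype.sum_prod_type, Prod.mk.injEq, ite_and]
  rw [Fintype.sum_eq_single a fun x hx => by simp [hx]]
  simp

lemma marginal_snd_eq (π : (α × β) × γ → ℝ) (b : β) (c : γ) :
    marginal π (fun ω => (ω.1.2, ω.2)) (b, c) = ∑ a, π ((a, b), c) := by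
  simp [marginal, sum_filter, Fintype.sum_prod_type, ite_and]

lemma marginal_fst_condProd {π : (α × β) × γ → ℝ} (hπ : ∀ ω, 0 ≤ π ω) :
    marginal (condProd π) (fun ω => (ω.1.1, ω.2)) = marginal π (fun ω => (ω.1.1, ω.2)) := by
  funext ⟨a, c⟩
  rw [marginal_fst_eq]
  simp only [condProd]
  rw [← sum_div, ← mul_sum, sum_marginal_fst π (fun ω => ω.1.2) (fun ω => ω.2)]
  -- Where c has no mass, the division by zero gives 0, and the marginal at (a, c) vanishes as well.
  rcases eq_or_ne (marginal π (fun ω => ω.2) c) 0 with h | h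
  · have h2 := sum_marginal_fst π (fun ω => ω.1.1) (fun ω => ω.2) c
    rw [h, sum_eq_zero_iff_of_nonneg fun _ _ => marginal_nonneg hπ _ _] at h2
    simp [h2 a (mem_univ a)]
  · rw [mul_div_cancel_right₀ _ h]

lemma marginal_snd_condProd {π : (α × β) × γ → ℝ} (hπ : ∀ ω, 0 ≤ π ω) :
    marginal (condProd π) (fun ω => (ω.1.2, ω.2)) = marginal π (fun ω => (ω.1.2, ω.2)) := by
  funext ⟨b, c⟩
  rw [marginal_snd_eq]
  simp only [condProd]
  rw [← sum_div, ← sum_mul, sum_marginal_fst π (fun ω => ω.1.1) (fun ω => ω.2)]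
  rcases eq_or_ne (marginal π (fun ω => ω.2) c) 0 with h | h
  · have h2 := sum_marginal_fst π (fun ω => ω.1.2) (fun ω => ω.2) c
    rw [h, sum_eq_zero_iff_of_nonneg fun _ _ => marginal_nonneg hπ _ _] at h2
    simp [h2 b (mem_univ b)]
  · rw [mul_div_cancel_left₀ _ h]

lemma pos_of_condProd_pos {π : (α × β) × γ → ℝ} (hπ : ∀ ω, 0 ≤ π ω) {ω : (α × β) × γ}
    (h : 0 < condProd π ω) :
    (∃ b, 0 < π ((ω.1.1, b), ω.2)) ∧ ∃ a, 0 < π ((a, ω.1.2), ω.2) := by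
  have h1 : 0 < marginal π (fun ω => (ω.1.1, ω.2)) (ω.1.1, ω.2) :=
    (marginal_nonneg hπ _ _).lt_of_ne fun h0 => by simp [condProd, ← h0] at h
  have h2 : 0 < marginal π (fun ω => (ω.1.2, ω.2)) (ω.1.2, ω.2) :=
    (marginal_nonneg hπ _ _).lt_of_ne fun h0 => by simp [condProd, ← h0] at h
  rw [marginal_fst_eq] at h1
  rw [marginal_snd_eq] at h2
  obtain ⟨b, -, hb⟩ := exists_lt_of_sum_lt (f := fun _ => (0 : ℝ)) (by simpa using h1)
  obtain ⟨a, -, ha⟩ := exists_lt_of_sum_lt (f := fun _ => (0 : ℝ)) (by simpa using h2)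
  exact ⟨⟨b, hb⟩, a, ha⟩

lemma entropy_condProd {π : (α × β) × γ → ℝ} (hπ : ∀ ω, 0 ≤ π ω) :
    entropy (condProd π) + entropy (marginal π fun ω => ω.2) =
      entropy (marginal π fun ω => (ω.1.1, ω.2)) + entropy (marginal π fun ω => (ω.1.2, ω.2)) := by
  set p := marginal π fun ω => (ω.1.1, ω.2) with hp
  set q := marginal π fun ω => (ω.1.2, ω.2) with hq
  set s := marginal π fun ω => ω.2 with hs
  have hs' : marginal (condProd π) (fun ω => ω.2) = s := by
    have h1 := marginal_marginal (condProd π) (fun ω => (ω.1.1, ω.2)) Prod.snd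
    rw [marginal_fst_condProd hπ, marginal_marginal] at h1
    exact h1.symm
  have e1 := entropy_marginal (condProd π) fun ω => (ω.1.1, ω.2)
  have e2 := entropy_marginal (condProd π) fun ω => (ω.1.2, ω.2)
  have e3 := entropy_marginal (condProd π) fun ω => ω.2
  rw [marginal_fst_condProd hπ, ← hp] at e1
  rw [marginal_snd_condProd hπ, ← hq] at e2
  rw [hs'] at e3
  rw [e1, e2, e3, entropy, ← sum_neg_distrib, ← sum_neg_distrib, ← sum_neg_distrib,
    ← sum_add_distrib, ← sum_add_distrib]
  refine sum_congr rfl fun ω _ => ?_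
  rcases (condProd_nonneg hπ ω).eq_or_lt with h | h
  · simp [← h]
  have h1 : p (ω.1.1, ω.2) ≠ 0 := fun h0 => by simp [condProd, ← hp, h0] at h
  have h2 : q (ω.1.2, ω.2) ≠ 0 := fun h0 => by simp [condProd, ← hq, h0] at h
  have h3 : s ω.2 ≠ 0 := fun h0 => by simp [condProd, ← hs, h0] at h
  have h4 : Real.log (condProd π ω) =
      Real.log (p (ω.1.1, ω.2)) + Real.log (q (ω.1.2, ω.2)) - Real.log (s ω.2) := by
    rw [condProd, Real.log_div (mul_ne_zero h1 h2) h3, Real.log_mul h1 h2]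
  rw [Real.negMulLog, h4]
  ring

end Entropy

/-! ### Cutting walks at given times -/

section Walks

open SimpleGraph

variable {V : Type*} {G : SimpleGraph V}

lemma append_inj_of_length_eq {a u b : V} (Q Q' : G.Walk a u) (R R' : G.Walk u b)
    (hl : Q.length = Q'.length) (h : Q.append R = Q'.append R') : Q = Q' ∧ R = R' := by
  induction Q with
  | nil =>
    have : Q'.Nil := Walk.length_eq_zero_iff.1 (by simpa using hl.symm)
    cases Q' with
    | nil => exact ⟨rfl, h⟩
    | cons h' p => simp at this
  | cons h1 p ih =>
    cases Q' with
    | nil => simp at hl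
    | cons h2 q =>
      simp only [Walk.cons_append, Walk.cons.injEq] at h
      obtain ⟨rfl, h⟩ := h
      obtain ⟨h3, h4⟩ := ih q R R' (by simpa using hl) (eq_of_heq h)
      exact ⟨by rw [h3], h4⟩

lemma exists_eq_append {a b : V} (P : G.Walk a b) {m : ℕ} (hm : m ≤ P.length) {u : V}
    (hu : P.getVert m = u) :
    ∃ (Q : G.Walk a u) (R : G.Walk u b), Q.length = m ∧ R.length = P.length - m ∧
      P = Q.append R := by
  subst hu
  exact ⟨P.take m, P.drop m, by simp [hm], by simp, (P.append_take_drop_eq m).symm⟩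

lemma card_walks_through [Fintype V] [DecidableEq V] [DecidableRel G.Adj] (a b u v : V)
    (m n l : ℕ) :
    #{P ∈ G.finsetWalkLength (m + n + l) a b | P.getVert m = u ∧ P.getVert (m + n) = v} =
      #(G.finsetWalkLength m a u) * (#(G.finsetWalkLength n u v) * #(G.finsetWalkLength l v b)) := by
  rw [← card_product, ← card_product]
  symm
  refine card_bij (fun t _ => t.1.append (t.2.1.append t.2.2)) ?_ ?_ ?_
  · rintro ⟨Q, R, S⟩ h
    simp only [mem_product, SimpleGraph.mem_finsetWalkLength_iff] at h
    obtain ⟨h1, h2, h3⟩ := h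
    subst h1 h2 h3
    simp [SimpleGraph.mem_finsetWalkLength_iff, Walk.getVert_append, add_assoc]
  · rintro ⟨Q, R, S⟩ h ⟨Q', R', S'⟩ h' heq
    simp only [mem_product, SimpleGraph.mem_finsetWalkLength_iff] at h h'
    obtain ⟨e1, e2⟩ := append_inj_of_length_eq _ _ _ _ (h.1.trans h'.1.symm) heq
    obtain ⟨e3, e4⟩ := append_inj_of_length_eq _ _ _ _ (h.2.1.trans h'.2.1.symm) e2
    exact Prod.ext e1 (Prod.ext e3 e4)
  · intro P hP
    simp only [mem_filter, SimpleGraph.mem_finsetWalkLength_iff] at hP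
    obtain ⟨h1, h2, h3⟩ := hP
    obtain ⟨Q, R, hQ, hR, rfl⟩ := exists_eq_append P (by omega : m ≤ P.length) h2
    have h4 : R.getVert n = v := by
      rw [Walk.getVert_append, if_neg (by omega)] at h3
      simpa [hQ] using h3
    obtain ⟨S, T, hS, hT, rfl⟩ := exists_eq_append R (by omega : n ≤ R.length) h4
    refine ⟨(Q, S, T), ?_, rfl⟩
    simp only [mem_product, SimpleGraph.mem_finsetWalkLength_iff]
    refine ⟨hQ, hS, by omega⟩

end Walks

/-! ### Geodesics of the hypercube and their middles -/

section Hypercube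

variable {d : ℕ}

lemma hammingDist_le_length {a b : Fin d → Bool} (P : (hypercube d).Walk a b) :
    hammingDist a b ≤ P.length := by
  induction P with
  | nil => simp
  | @cons x y z h p ih =>
    have h1 : hammingDist x y = 1 := h
    have := hammingDist_triangle x y z
    rw [SimpleGraph.Walk.length_cons]
    omega

/-- A step towards b corrects one of the n + 1 coordinates in which a and b differ. -/
lemma card_neighbors_toward {a b : Fin d → Bool} {n : ℕ} (h : hammingDist a b = n + 1) :
    #{w | (hypercube d).Adj a w ∧ hammingDist w b = n} = n + 1 := by
  rw [← h]
  symm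
  refine card_bij (fun i _ => Function.update a i (b i)) ?_ ?_ ?_
  · intro i hi
    have hi' : a i ≠ b i := (mem_filter.1 hi).2
    refine mem_filter.2 ⟨mem_univ _, ?_, ?_⟩
    · change hammingDist a (Function.update a i (b i)) = 1
      have : (univ.filter fun j => a j ≠ Function.update a i (b i) j) = {i} := by
        ext j
        rcases eq_or_ne j i with rfl | hj
        · simpa using hi'
        · simp [hj]
      rw [hammingDist, this, card_singleton]
    · have : (univ.filter fun j => Function.update a i (b i) j ≠ b j) =
          (univ.filter fun j => a j ≠ b j).erase i := by
        ext j
        rcases eq_or_ne j i with rfl | hj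
        · simp
        · simp [hj]
      rw [hammingDist, this, card_erase_of_mem hi]
      rw [hammingDist] at h
      omega
  · intro i hi j hj hij
    by_contra hne
    have := congrFun hij i
    rw [Function.update_self, Function.update_of_ne hne] at this
    exact (mem_filter.1 hi).2 this.symm
  · intro w hw
    obtain ⟨-, h1, h2⟩ := mem_filter.1 hw
    have h1 : hammingDist a w = 1 := h1
    rw [hammingDist, card_eq_one] at h1
    obtain ⟨i, hi⟩ := h1
    have hj : ∀ j, a j ≠ w j ↔ j = i := fun j => by
      have := congrArg (j ∈ ·) hi
      simpa using this
    have hwi : w i = b i := by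
      by_contra hne
      have hsub : (univ.filter fun j => a j ≠ b j) ⊆ univ.filter fun j => w j ≠ b j := by
        intro j hjm
        simp only [mem_filter, mem_univ, true_and] at hjm ⊢
        rcases eq_or_ne j i with rfl | hji
        · exact hne
        · rwa [← not_not.1 (mt (hj j).1 hji)]
      have := card_le_card hsub
      rw [hammingDist] at h h2
      omega
    refine ⟨i, ?_, ?_⟩
    · simp only [mem_filter, mem_univ, true_and]
      rw [← hwi]
      exact (hj i).2 rfl
    · funext j
      rcases eq_or_ne j i with rfl | hji
      · simp [hwi]
      · rw [Function.update_of_ne hji]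
        exact not_not.1 (mt (hj j).1 hji)

lemma card_finsetWalkLength_hypercube {n : ℕ} {a b : Fin d → Bool} (h : hammingDist a b = n) :
    #((hypercube d).finsetWalkLength n a b) = n.factorial := by
  induction n generalizing a with
  | zero =>
    rw [hammingDist_eq_zero] at h
    subst h
    simp [SimpleGraph.finsetWalkLength]
  | succ n ih =>
    have e : ∀ m (x y : Fin d → Bool), #((hypercube d).finsetWalkLength m x y) =
        ((hypercube d).adjMatrix ℕ ^ m) x y := fun m x y => by
      rw [SimpleGraph.adjMatrix_pow_apply_eq_card_walk]
      simp
    rw [e, pow_succ', SimpleGraph.adjMatrix_mul_apply]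
    simp_rw [← e]
    rw [← sum_subset (s₁ := {w | (hypercube d).Adj a w ∧ hammingDist w b = n})
      (fun w hw => by simpa using (mem_filter.1 hw).2.1), sum_congr rfl (g := fun _ => n.factorial)
      (fun w hw => ih (mem_filter.1 hw).2.2), sum_const, card_neighbors_toward h, smul_eq_mul,
      Nat.factorial_succ]
    -- A neighbour of a is at distance at least n from b; if not exactly n, it is too far for a walk
    -- of length n.
    intro w hw hw'
    rw [card_eq_zero, eq_empty_iff_forall_notMem]
    intro P hP
    rw [SimpleGraph.mem_finsetWalkLength_iff] at hP
    have h1 : (hypercube d).Adj a w := by simpa using hw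
    have h2 : hammingDist w b ≠ n := fun h2 => hw' (mem_filter.2 ⟨mem_univ _, h1, h2⟩)
    have h3 : hammingDist a w = 1 := h1
    have h4 := hammingDist_le_length P
    have h5 := hammingDist_triangle a w b
    omega

lemma dist_hypercube (a b : Fin d → Bool) : (hypercube d).dist a b = hammingDist a b := by
  have h : 0 < #((hypercube d).finsetWalkLength (hammingDist a b) a b) := by
    rw [card_finsetWalkLength_hypercube rfl]
    exact Nat.factorial_pos _
  obtain ⟨P, hP⟩ := card_pos.1 h
  rw [SimpleGraph.mem_finsetWalkLength_iff] at hP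
  refine le_antisymm (hP ▸ SimpleGraph.dist_le P) ?_
  obtain ⟨Q, hQ⟩ := SimpleGraph.Reachable.exists_walk_length_eq_dist ⟨P⟩
  exact hQ ▸ hammingDist_le_length Q

/-- The middle of a walk as an ordered pair of vertices, which are equal if the length is even. -/
def middlePair {V : Type*} {G : SimpleGraph V} {a b : V} (P : G.Walk a b) : V × V :=
  (P.getVert (P.length / 2), P.getVert ((P.length + 1) / 2))

/-- The vertex or edge given by a pair of vertices that are equal or adjacent. -/
def pairToMiddle {V : Type*} [DecidableEq V] (c : V × V) : V ⊕ Sym2 V :=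
  if c.1 = c.2 then Sum.inl c.1 else Sum.inr s(c.1, c.2)

lemma middle_eq_pairToMiddle {V : Type*} [DecidableEq V] {G : SimpleGraph V} {a b : V}
    (P : G.Walk a b) : middle P = pairToMiddle (middlePair P) := by
  rw [middle, middlePair, pairToMiddle]
  split_ifs with h1 h2 h2
  · rfl
  · obtain ⟨k, hk⟩ := h1
    exact absurd (congrArg P.getVert (by omega)) h2
  · obtain ⟨k, hk⟩ := Nat.not_even_iff_odd.1 h1
    have := P.adj_getVert_succ (i := P.length / 2) (by omega)
    rw [show P.length / 2 + 1 = (P.length + 1) / 2 by omega] at this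
    exact absurd h2 this.ne
  · obtain ⟨k, hk⟩ := Nat.not_even_iff_odd.1 h1
    rw [show P.length / 2 + 1 = (P.length + 1) / 2 by omega]

/-- The pair `u, v` is in the middle between `a` and `b`. -/
def IsMid (a b : Fin d → Bool) (c : (Fin d → Bool) × (Fin d → Bool)) : Prop :=
  hammingDist a c.1 = hammingDist c.2 b ∧ hammingDist c.1 c.2 ≤ 1 ∧
    hammingDist a b = hammingDist a c.1 + hammingDist c.1 c.2 + hammingDist c.2 b

instance (a b : Fin d → Bool) (c : (Fin d → Bool) × (Fin d → Bool)) : Decidable (IsMid a b c) :=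
  inferInstanceAs (Decidable (_ ∧ _ ∧ _))

/-- The number of midpoints of two vertices at distance `k`. -/
noncomputable def numMid (k : ℕ) : ℝ := (k.factorial : ℝ) / ((k / 2).factorial : ℝ) ^ 2

lemma numMid_pos (k : ℕ) : 0 < numMid k := by
  rw [numMid]
  positivity

/-- The probability that a uniform geodesic from `a` to `b` has the middle `c`. -/
noncomputable def midWeight (a b : Fin d → Bool) (c : (Fin d → Bool) × (Fin d → Bool)) : ℝ :=
  if IsMid a b c then (numMid (hammingDist a b))⁻¹ else 0

lemma midWeight_nonneg (a b : Fin d → Bool) (c : (Fin d → Bool) × (Fin d → Bool)) :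
    0 ≤ midWeight a b c := by
  rw [midWeight]
  split_ifs
  · exact (inv_pos.2 (numMid_pos _)).le
  · rfl

lemma geodesics_eq (a b : Fin d → Bool) :
    geodesics (hypercube d) a b = (hypercube d).finsetWalkLength (hammingDist a b) a b := by
  rw [geodesics, dist_hypercube]

lemma card_geodesics (a b : Fin d → Bool) :
    #(geodesics (hypercube d) a b) = (hammingDist a b).factorial := by
  rw [geodesics_eq, card_finsetWalkLength_hypercube rfl]

lemma isMid_middlePair {a b : Fin d → Bool} {P : (hypercube d).Walk a b}
    (hP : P.length = hammingDist a b) : IsMid a b (middlePair P) := by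
  obtain ⟨Q, R, hQ, hR, h⟩ := exists_eq_append P (by omega : P.length / 2 ≤ P.length) rfl
  have h4 : R.getVert ((P.length + 1) / 2 - P.length / 2) = P.getVert ((P.length + 1) / 2) := by
    have h5 := congrArg (fun W => W.getVert ((P.length + 1) / 2)) h
    simp only [SimpleGraph.Walk.getVert_append] at h5
    rw [if_neg (by omega), hQ] at h5
    exact h5.symm
  obtain ⟨S, T, hS, hT, -⟩ := exists_eq_append R (by omega) h4
  have h5 := hammingDist_le_length Q
  have h6 := hammingDist_le_length S
  have h7 := hammingDist_le_length T
  have h8 := hammingDist_triangle a (middlePair P).1 b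
  have h9 := hammingDist_triangle (middlePair P).1 (middlePair P).2 b
  simp only [IsMid, middlePair] at *
  omega

/-- A geodesic with middle c is a geodesic from a to c.1, at most one edge, and a geodesic from c.2
to b. With m = ⌊k/2⌋ this gives m!² of the k! geodesics, the same proportion for every middle. -/
lemma card_middlePair_div (a b : Fin d → Bool) (c : (Fin d → Bool) × (Fin d → Bool)) :
    (#{P ∈ geodesics (hypercube d) a b | middlePair P = c} : ℝ) /
      #(geodesics (hypercube d) a b) = midWeight a b c := by
  rw [card_geodesics, geodesics_eq, midWeight]
  split_ifs with h
  · obtain ⟨h1, h2, h3⟩ := h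
    have h4 : hammingDist a b / 2 = hammingDist a c.1 := by omega
    have h5 : (hammingDist a b + 1) / 2 = hammingDist a c.1 + hammingDist c.1 c.2 := by omega
    have h6 : {P ∈ (hypercube d).finsetWalkLength (hammingDist a b) a b | middlePair P = c} =
        {P ∈ (hypercube d).finsetWalkLength
            (hammingDist a c.1 + hammingDist c.1 c.2 + hammingDist c.2 b) a b |
          P.getVert (hammingDist a c.1) = c.1 ∧
            P.getVert (hammingDist a c.1 + hammingDist c.1 c.2) = c.2} := by
      rw [← h3]
      refine filter_congr fun P hP => ?_
      rw [SimpleGraph.mem_finsetWalkLength_iff] at hP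
      rw [middlePair, hP, h4, h5, Prod.ext_iff]
    rw [h6, card_walks_through, card_finsetWalkLength_hypercube rfl,
      card_finsetWalkLength_hypercube rfl, card_finsetWalkLength_hypercube rfl, numMid, h4, ← h1]
    have h7 : (hammingDist c.1 c.2).factorial = 1 := by
      interval_cases hammingDist c.1 c.2 <;> rfl
    rw [h7, inv_div]
    push_cast
    ring
  · rw [div_eq_zero_iff, Nat.cast_eq_zero, card_eq_zero]
    left
    rw [filter_eq_empty_iff]
    rintro P hP rfl
    exact h (isMid_middlePair (SimpleGraph.mem_finsetWalkLength_iff.1 hP))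

lemma sum_midWeight (a b : Fin d → Bool) : ∑ c, midWeight a b c = 1 := by
  simp_rw [← card_middlePair_div]
  rw [← sum_div, ← Nat.cast_sum, ← card_eq_sum_card_fiberwise fun _ _ => mem_univ _]
  refine div_self (Nat.cast_ne_zero.2 ?_)
  rw [card_geodesics]
  exact Nat.factorial_ne_zero _

lemma sum_geodesics_middle (a b : Fin d → Bool) (X : (Fin d → Bool) ⊕ Sym2 (Fin d → Bool)) :
    ∑ P ∈ geodesics (hypercube d) a b with middle P = X,
      1 / (#(geodesics (hypercube d) a b) : ℝ) =
      ∑ c with pairToMiddle c = X, midWeight a b c := by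
  rw [sum_congr rfl fun c _ => (card_middlePair_div a b c).symm, ← sum_div,
    ← sum_div, ← Nat.cast_sum, sum_const, nsmul_eq_mul, mul_one]
  congr 2
  rw [card_eq_sum_card_fiberwise (f := middlePair) (t := {c | pairToMiddle c = X})]
  · refine sum_congr rfl fun c hc => ?_
    rw [filter_filter]
    congr 1
    refine filter_congr fun P _ => ?_
    rw [middle_eq_pairToMiddle]
    exact and_iff_right_of_imp fun h => h ▸ (mem_filter.1 hc).2
  · intro P hP
    have := (mem_filter.1 hP).2
    rw [middle_eq_pairToMiddle] at this
    simpa using this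

lemma pairToMiddle_mem_midpoints {a b : Fin d → Bool} {c : (Fin d → Bool) × (Fin d → Bool)}
    (h : IsMid a b c) : pairToMiddle c ∈ midpoints (hypercube d) a b := by
  obtain ⟨h1, h2, h3⟩ := h
  have h4 := hammingDist_comm a c.1
  have h5 := hammingDist_comm c.1 a
  simp only [midpoints, dist_hypercube, Set.mem_ofPred_eq]
  rw [pairToMiddle]
  split_ifs with hc
  · rw [← hc] at h1 h3
    simp only [hammingDist_self] at h3
    exact Or.inl ⟨c.1, rfl, by omega, by omega⟩
  · have := hammingDist_pos.2 hc
    exact Or.inr ⟨c.1, c.2, rfl, (by omega : hammingDist c.1 c.2 = 1), by omega, by omega⟩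

end Hypercube

/-! ### Optimal transportations -/

section Transport

variable {V : Type*} [Fintype V] [DecidableEq V] {G : SimpleGraph V} {μA μB : V → ℝ}
  {τ : V → V → ℝ}

lemma IsTransport.le_left (h : IsTransport μA μB τ) (a b : V) : τ a b ≤ μA a := by
  rw [← h.sum_right a]
  exact single_le_sum (f := τ a) (fun b _ => h.nonneg a b) (mem_univ b)

lemma IsTransport.le_right (h : IsTransport μA μB τ) (a b : V) : τ a b ≤ μB b := by
  rw [← h.sum_left b]
  exact single_le_sum (f := fun a => τ a b) (fun a _ => h.nonneg a b) (mem_univ a)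

lemma IsOptimal.wasserstein_eq (h : IsOptimal G μA μB τ) : wasserstein G μA μB = cost G τ := by
  refine IsLeast.csInf_eq ⟨⟨τ, h.1, rfl⟩, ?_⟩
  rintro w ⟨τ', h', rfl⟩
  exact h.2 τ' h'

lemma isCompact_transport (hA : μA ∈ stdSimplex ℝ V) :
    IsCompact {τ : V → V → ℝ | IsTransport μA μB τ} := by
  have hsub : {τ : V → V → ℝ | IsTransport μA μB τ} ⊆ Set.Icc 0 1 := by
    intro τ h
    have h1 : ∀ a, μA a ≤ 1 := fun a => by
      rw [← hA.2]
      exact single_le_sum (f := μA) (fun x _ => hA.1 x) (mem_univ a)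
    exact ⟨fun a b => h.nonneg a b, fun a b => (h.le_left a b).trans (h1 a)⟩
  refine isCompact_Icc.of_isClosed_subset ?_ hsub
  have : {τ : V → V → ℝ | IsTransport μA μB τ} =
      (⋂ a, ⋂ b, {τ : V → V → ℝ | 0 ≤ τ a b}) ∩
        ((⋂ a, {τ : V → V → ℝ | ∑ b, τ a b = μA a}) ∩
          ⋂ b, {τ : V → V → ℝ | ∑ a, τ a b = μB b}) := by
    ext τ
    simp only [Set.mem_ofPred_eq, Set.mem_inter_iff, Set.mem_iInter]
    exact ⟨fun h => ⟨h.1, h.2, h.3⟩, fun h => ⟨h.1, h.2.1, h.2.2⟩⟩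
  rw [this]
  refine IsClosed.inter ?_ (IsClosed.inter ?_ ?_)
  · exact isClosed_iInter fun a => isClosed_iInter fun b =>
      isClosed_le continuous_const (by fun_prop)
  · exact isClosed_iInter fun a => isClosed_eq (by fun_prop) continuous_const
  · exact isClosed_iInter fun b => isClosed_eq (by fun_prop) continuous_const

lemma continuous_cost : Continuous (cost G) := by
  unfold cost
  fun_prop

lemma exists_isOptimal_max (hA : μA ∈ stdSimplex ℝ V) (hB : μB ∈ stdSimplex ℝ V)
    {F : (V → V → ℝ) → ℝ} (hF : Continuous F) :
    ∃ τ, IsOptimal G μA μB τ ∧ ∀ τ', IsOptimal G μA μB τ' → F τ' ≤ F τ := by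
  have hne : {τ : V → V → ℝ | IsTransport μA μB τ}.Nonempty :=
    ⟨fun a b => μA a * μB b, fun a b => mul_nonneg (hA.1 a) (hB.1 b),
      fun a => by rw [← mul_sum, hB.2, mul_one], fun b => by rw [← sum_mul, hA.2, one_mul]⟩
  obtain ⟨τ₀, h₀, hmin⟩ :=
    (isCompact_transport hA).exists_isMinOn hne (continuous_cost (G := G)).continuousOn
  have hopt : IsOptimal G μA μB τ₀ := ⟨h₀, fun τ' h' => hmin h'⟩
  have hset : {τ | IsOptimal G μA μB τ} =
      {τ : V → V → ℝ | IsTransport μA μB τ} ∩ {τ | cost G τ ≤ cost G τ₀} := by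
    ext τ
    exact ⟨fun h => ⟨h.1, h.2 τ₀ h₀⟩, fun h => ⟨h.1, fun τ' h' => le_trans h.2 (hmin h')⟩⟩
  have hcomp : IsCompact {τ | IsOptimal G μA μB τ} := by
    rw [hset]
    exact (isCompact_transport hA).inter_right (isClosed_le continuous_cost continuous_const)
  obtain ⟨τ, h, hmax⟩ := hcomp.exists_isMaxOn ⟨τ₀, hopt⟩ hF.continuousOn
  exact ⟨τ, h, fun τ' h' => hmax h'⟩

/-- Two-point cyclical monotonicity: otherwise rerouting a little mass from (a,b), (a',b') to
(a,b'), (a',b) would lower the cost. -/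
lemma IsOptimal.exchange (h : IsOptimal G μA μB τ) {a b a' b' : V} (h1 : 0 < τ a b)
    (h2 : 0 < τ a' b') :
    G.dist a b ^ 2 + G.dist a' b' ^ 2 ≤ G.dist a b' ^ 2 + G.dist a' b ^ 2 := by
  rcases eq_or_ne a a' with rfl | ha
  · rw [add_comm]
  rcases eq_or_ne b b' with rfl | hb
  · rfl
  set ε := min (τ a b) (τ a' b') with hε
  have hε0 : 0 < ε := lt_min h1 h2
  let s : V → ℝ := fun x => (if x = a then 1 else 0) - if x = a' then 1 else 0
  let t : V → ℝ := fun y => (if y = b then 1 else 0) - if y = b' then 1 else 0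
  have hs : ∑ x, s x = 0 := by simp [s]
  have ht : ∑ y, t y = 0 := by simp [t]
  -- Since s and t have total mass 0, both marginals are unchanged; ε is the largest mass that can
  -- be moved.
  let τ' : V → V → ℝ := fun x y => τ x y - ε * (s x * t y)
  have htr : IsTransport μA μB τ' := by
    refine ⟨fun x y => ?_, fun x => ?_, fun y => ?_⟩
    · have e0 := h.1.nonneg x y
      have e1 : ε ≤ τ a b := min_le_left _ _
      have e2 : ε ≤ τ a' b' := min_le_right _ _
      simp only [τ', s, t]
      by_cases c1 : x = a
      · subst c1
        by_cases c2 : y = b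
        · subst c2
          simp [ha, hb, e1]
        · by_cases c3 : y = b'
          · subst c3
            simp [ha, c2]
            linarith
          · simp [c2, c3, e0]
      · by_cases c4 : x = a'
        · subst c4
          by_cases c2 : y = b
          · subst c2
            simp [c1, hb]
            linarith
          · by_cases c3 : y = b'
            · subst c3
              simp [c1, c2, e2]
            · simp [c2, c3, e0]
        · simp [c1, c4, e0]
    · simp only [τ']
      rw [sum_sub_distrib, h.1.sum_right, ← mul_sum, ← mul_sum, ht]
      ring
    · simp only [τ']
      rw [sum_sub_distrib, h.1.sum_left, ← mul_sum, ← sum_mul, hs]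
      ring
  have hc := h.2 τ' htr
  have e : cost G τ' = cost G τ - ε * ((G.dist a b : ℝ) ^ 2 - (G.dist a b' : ℝ) ^ 2 -
      ((G.dist a' b : ℝ) ^ 2 - (G.dist a' b' : ℝ) ^ 2)) := by
    simp only [cost, τ', sub_mul, sum_sub_distrib]
    congr 1
    simp only [mul_assoc, ← mul_sum]
    congr 1
    simp [s, t, sub_mul, sum_sub_distrib]
  rw [e] at hc
  have h3 : (G.dist a b : ℝ) ^ 2 - (G.dist a b' : ℝ) ^ 2 -
      ((G.dist a' b : ℝ) ^ 2 - (G.dist a' b' : ℝ) ^ 2) ≤ 0 := by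
    by_contra hpos
    have := mul_pos hε0 (not_le.1 hpos)
    linarith
  have h4 : (G.dist a b : ℝ) ^ 2 + (G.dist a' b' : ℝ) ^ 2 ≤
      (G.dist a b' : ℝ) ^ 2 + (G.dist a' b : ℝ) ^ 2 := by linarith
  exact_mod_cast h4

end Transport

/-! ### The random geodesic and conditional independence of its ends -/

section Plan

variable {d : ℕ} {μA μB : (Fin d → Bool) → ℝ} {τ : (Fin d → Bool) → (Fin d → Bool) → ℝ}

/-- Let p and q be the distances from c to the ends of the two pairs, and e the length of c. By the
triangle inequality, the hypothesis gives (2p+e)² + (2q+e)² ≤ 2(p+q+e)², that is, (p-q)² ≤ 0. Then p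
= q and all the inequalities used are equalities. -/
lemma IsMid.exchange {a b a' b' : Fin d → Bool} {c : (Fin d → Bool) × (Fin d → Bool)}
    (h : IsMid a b c) (h' : IsMid a' b' c)
    (hex : hammingDist a b ^ 2 + hammingDist a' b' ^ 2 ≤
      hammingDist a b' ^ 2 + hammingDist a' b ^ 2) : IsMid a b' c := by
  obtain ⟨h1, h2, h3⟩ := h
  obtain ⟨h1', -, h3'⟩ := h'
  have t1 := hammingDist_triangle a c.1 b'
  have t2 := hammingDist_triangle c.1 c.2 b'
  have t3 := hammingDist_triangle a' c.1 b
  have t4 := hammingDist_triangle c.1 c.2 b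
  rw [h3, h3', h1, h1'] at hex
  rw [h1] at t1
  rw [h1'] at t3
  rw [IsMid, h1]
  generalize hammingDist c.2 b = p at *
  generalize hammingDist c.2 b' = q at *
  generalize hammingDist c.1 c.2 = e at *
  generalize hammingDist a b' = x at *
  generalize hammingDist a' b = y at *
  have hx : x ^ 2 ≤ (p + e + q) ^ 2 := Nat.pow_le_pow_left (by omega) 2
  have hy : y ^ 2 ≤ (p + e + q) ^ 2 := Nat.pow_le_pow_left (by omega) 2
  have hpq : p = q := by
    zify at hex hx hy ⊢
    have : ((p : ℤ) - q) ^ 2 = 0 := le_antisymm (by nlinarith) (sq_nonneg _)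
    have := pow_eq_zero_iff (two_ne_zero) |>.1 this
    omega
  subst hpq
  refine ⟨rfl, h2, le_antisymm (by omega) ?_⟩
  exact (Nat.pow_le_pow_iff_left two_ne_zero).1 (by omega)

lemma IsOptimal.isMid_exchange (h : IsOptimal (hypercube d) μA μB τ) {a b a' b' : Fin d → Bool}
    {c : (Fin d → Bool) × (Fin d → Bool)} (h1 : 0 < τ a b) (h2 : 0 < τ a' b')
    (hm : IsMid a b c) (hm' : IsMid a' b' c) : IsMid a b' c :=
  hm.exchange hm' (by simpa only [dist_hypercube] using h.exchange h1 h2)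

/-- An optimal transportation never crosses an edge in both directions: exchanging the ends would
avoid the edge, and (2p+e)² + (2q+e)² ≤ 2(p+q)² fails for e > 0. This makes ordered middles as good
as unordered ones. -/
lemma IsOptimal.not_isMid_swap (h : IsOptimal (hypercube d) μA μB τ) {a b a' b' : Fin d → Bool}
    {c : (Fin d → Bool) × (Fin d → Bool)} (h1 : 0 < τ a b) (h2 : 0 < τ a' b')
    (hm : IsMid a b c) (hm' : IsMid a' b' c.swap) : c.1 = c.2 := by
  have hex := h.exchange h1 h2
  simp only [dist_hypercube] at hex
  by_contra hne
  have hpos := hammingDist_pos.2 hne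
  obtain ⟨e1, e2, e3⟩ := hm
  obtain ⟨f1, f2, f3⟩ := hm'
  simp only [Prod.fst_swap, Prod.snd_swap] at f1 f2 f3
  have t1 := hammingDist_triangle a c.1 b'
  have t3 := hammingDist_triangle a' c.2 b
  rw [hammingDist_comm c.2 c.1] at f3
  rw [e3, f3, e1, f1] at hex
  rw [e1] at t1
  rw [f1] at t3
  generalize hammingDist c.2 b = p at *
  generalize hammingDist c.1 b' = q at *
  generalize hammingDist c.1 c.2 = e at *
  generalize hammingDist a b' = x at *
  generalize hammingDist a' b = y at *
  have hx : x ^ 2 ≤ (p + q) ^ 2 := Nat.pow_le_pow_left (by omega) 2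
  have hy : y ^ 2 ≤ (p + q) ^ 2 := Nat.pow_le_pow_left (by omega) 2
  zify at hex hx hy hpos
  have hp : (0 : ℤ) ≤ p := by positivity
  have hq : (0 : ℤ) ≤ q := by positivity
  nlinarith [sq_nonneg ((p : ℤ) - q), mul_nonneg hp hpos.le, mul_nonneg hq hpos.le,
    mul_pos hpos hpos]

/-- The joint law of the ends and the middle of the random geodesic given by `τ`. -/
noncomputable def plan (τ : (Fin d → Bool) → (Fin d → Bool) → ℝ)
    (ω : ((Fin d → Bool) × (Fin d → Bool)) × ((Fin d → Bool) × (Fin d → Bool))) : ℝ :=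
  τ ω.1.1 ω.1.2 * midWeight ω.1.1 ω.1.2 ω.2

/-- The conditional entropy of the middle of the random geodesic given its ends. -/
noncomputable def gain (τ : (Fin d → Bool) → (Fin d → Bool) → ℝ) : ℝ :=
  ∑ e : (Fin d → Bool) × (Fin d → Bool), τ e.1 e.2 * Real.log (numMid (hammingDist e.1 e.2))

lemma sum_plan (τ : (Fin d → Bool) → (Fin d → Bool) → ℝ) (a b : Fin d → Bool) :
    ∑ c, plan τ ((a, b), c) = τ a b := by
  simp only [plan]
  rw [← mul_sum, sum_midWeight, mul_one]

lemma plan_nonneg (hτ : ∀ a b, 0 ≤ τ a b) (ω) : 0 ≤ plan τ ω :=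
  mul_nonneg (hτ _ _) (midWeight_nonneg _ _ _)

lemma plan_pos_iff (τ : (Fin d → Bool) → (Fin d → Bool) → ℝ) (ω) :
    0 < plan τ ω ↔ 0 < τ ω.1.1 ω.1.2 ∧ IsMid ω.1.1 ω.1.2 ω.2 := by
  rw [plan, midWeight]
  split_ifs with h
  · simp [h, mul_pos_iff_of_pos_right (inv_pos.2 (numMid_pos _))]
  · simp [h]

/-- Chain rule: given the ends, the middle is uniform on `numMid` values. -/
lemma entropy_plan (τ : (Fin d → Bool) → (Fin d → Bool) → ℝ) :
    entropy (plan τ) = entropy (fun e : (Fin d → Bool) × (Fin d → Bool) => τ e.1 e.2) + gain τ := by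
  rw [entropy, entropy, gain, Fintype.sum_prod_type, ← sum_add_distrib]
  refine sum_congr rfl fun e _ => ?_
  simp only [plan, Real.negMulLog_mul, sum_add_distrib]
  rw [← sum_mul, ← mul_sum, sum_midWeight, one_mul]
  congr 2
  rw [← one_mul (Real.log _), ← sum_midWeight e.1 e.2, sum_mul]
  refine sum_congr rfl fun c _ => ?_
  rw [midWeight]
  split_ifs
  · rw [Real.negMulLog, Real.log_inv]
    ring
  · simp

lemma continuous_entropy_plan :
    Continuous fun τ : (Fin d → Bool) → (Fin d → Bool) → ℝ => entropy (plan τ) := by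
  unfold entropy plan
  refine continuous_finsetSum _ fun ω _ => Real.continuous_negMulLog.comp ?_
  fun_prop

/-- The middle and one end determine the distance between the ends. So the cost depends only on the
joint law of A and C, which `condProd` preserves. -/
lemma cost_of_isMid
    {ρ : ((Fin d → Bool) × (Fin d → Bool)) × ((Fin d → Bool) × (Fin d → Bool)) → ℝ}
    (hρ : ∀ ω, ρ ω ≠ 0 → IsMid ω.1.1 ω.1.2 ω.2) :
    cost (hypercube d) (fun a b => ∑ c, ρ ((a, b), c)) =
      ∑ y, marginal ρ (fun ω => (ω.1.1, ω.2)) y *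
        ((2 * hammingDist y.1 y.2.1 + hammingDist y.2.1 y.2.2 : ℕ) : ℝ) ^ 2 := by
  rw [← sum_mul_comp ρ (fun ω => (ω.1.1, ω.2)) fun y =>
    ((2 * hammingDist y.1 y.2.1 + hammingDist y.2.1 y.2.2 : ℕ) : ℝ) ^ 2,
    Fintype.sum_prod_type, Fintype.sum_prod_type, cost]
  refine sum_congr rfl fun a _ => sum_congr rfl fun b _ => ?_
  rw [sum_mul]
  refine sum_congr rfl fun c _ => ?_
  rcases eq_or_ne (ρ ((a, b), c)) 0 with h | h
  · simp [h]
  · obtain ⟨h1, -, h3⟩ := hρ _ h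
    rw [dist_hypercube]
    simp only at h1 h3 ⊢
    rw [h3, ← h1]
    congr 3
    omega

/-- The conditional product ρ is supported on triples with a genuine middle, by exchange, so its law
τ' of the ends is again optimal. Its entropy is H(A,C) + H(B,C) - H(C), and it is at most that of
`plan τ'`, hence at most the maximum. -/
lemma entropy_ends_middle_le (h : IsOptimal (hypercube d) μA μB τ)
    (hmax : ∀ τ', IsOptimal (hypercube d) μA μB τ' → entropy (plan τ') ≤ entropy (plan τ)) :
    entropy (marginal (plan τ) fun ω => (ω.1.1, ω.2)) +
        entropy (marginal (plan τ) fun ω => (ω.1.2, ω.2)) ≤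
      entropy (marginal (plan τ) fun ω => ω.2) + entropy (plan τ) := by
  have hπ := plan_nonneg h.1.nonneg
  set ρ := condProd (plan τ) with hρdef
  have hρ0 : ∀ ω, 0 ≤ ρ ω := condProd_nonneg hπ
  let τ' : (Fin d → Bool) → (Fin d → Bool) → ℝ := fun a b => ∑ c, ρ ((a, b), c)
  have hρm : ∀ ω, 0 < ρ ω → IsMid ω.1.1 ω.1.2 ω.2 := by
    intro ω hω
    obtain ⟨⟨b, hb⟩, a, ha⟩ := pos_of_condProd_pos hπ hω
    obtain ⟨hb1, hb2⟩ := (plan_pos_iff τ _).1 hb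
    obtain ⟨ha1, ha2⟩ := (plan_pos_iff τ _).1 ha
    exact h.isMid_exchange hb1 ha1 hb2 ha2
  have hfst := marginal_fst_condProd hπ
  have hsnd := marginal_snd_condProd hπ
  rw [← hρdef] at hfst hsnd
  have htr : IsTransport μA μB τ' := by
    refine ⟨fun a b => sum_nonneg fun c _ => hρ0 _, fun a => ?_, fun b => ?_⟩
    · simp only [τ']
      rw [sum_comm, ← h.1.sum_right a]
      simp_rw [← marginal_fst_eq, hfst, marginal_fst_eq]
      rw [sum_comm]
      exact sum_congr rfl fun b _ => sum_plan τ a b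
    · simp only [τ']
      rw [sum_comm, ← h.1.sum_left b]
      simp_rw [← marginal_snd_eq, hsnd, marginal_snd_eq]
      rw [sum_comm]
      exact sum_congr rfl fun a _ => sum_plan τ a b
  have hcost : cost (hypercube d) τ' = cost (hypercube d) τ := by
    have e1 := cost_of_isMid (ρ := ρ) fun ω hω => hρm ω ((hρ0 ω).lt_of_ne hω.symm)
    have e2 := cost_of_isMid (ρ := plan τ) fun ω hω =>
      ((plan_pos_iff τ ω).1 ((hπ ω).lt_of_ne hω.symm)).2
    simp only [sum_plan] at e2
    rw [hfst] at e1
    exact e1.trans e2.symm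
  have hopt : IsOptimal (hypercube d) μA μB τ' := ⟨htr, fun σ hσ => hcost.trans_le (h.2 σ hσ)⟩
  have hpos : ∀ ω, 0 < ρ ω → 0 < τ' ω.1.1 ω.1.2 := fun ω hω =>
    hω.trans_le (single_le_sum (f := fun c => ρ (ω.1, c)) (fun c _ => hρ0 _) (mem_univ ω.2))
  have hle : entropy ρ ≤ entropy (plan τ') := by
    -- On the support of ρ, `plan τ'` depends only on the ends, whose law is the same under both. So
    -- the cross entropy is exactly the entropy of `plan τ'`.
    refine (entropy_le_cross (g := plan τ') hρ0 (fun ω hω =>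
      (plan_pos_iff τ' ω).2 ⟨hpos ω hω, hρm ω hω⟩) ?_).trans_eq ?_
    · refine (sum_le_sum_of_subset_of_nonneg (filter_subset _ _)
        fun ω _ _ => plan_nonneg htr.nonneg ω).trans_eq ?_
      exact (Fintype.sum_prod_type _).trans
        ((sum_congr rfl fun e _ => sum_plan τ' e.1 e.2).trans (Fintype.sum_prod_type ρ).symm)
    · rw [entropy_plan, entropy, gain, ← sum_add_distrib, Fintype.sum_prod_type,
        ← sum_neg_distrib]
      refine sum_congr rfl fun e _ => ?_
      have : Real.negMulLog (τ' e.1 e.2) + τ' e.1 e.2 * Real.log (numMid (hammingDist e.1 e.2)) =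
          -(τ' e.1 e.2 * (Real.log (τ' e.1 e.2) - Real.log (numMid (hammingDist e.1 e.2)))) := by
        rw [Real.negMulLog]
        ring
      rw [this]
      congr 1
      conv_rhs => rw [show τ' e.1 e.2 = ∑ c, ρ (e, c) from rfl, sum_mul]
      refine sum_congr rfl fun c _ => ?_
      rcases (hρ0 (e, c)).eq_or_lt with h0 | h0
      · simp [← h0]
      · have hm := hρm _ h0
        have := hpos _ h0
        simp only at hm this
        rw [plan, midWeight, if_pos hm, Real.log_mul this.ne' (inv_pos.2 (numMid_pos _)).ne',
          Real.log_inv, ← sub_eq_add_neg]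
  have hcp := entropy_condProd hπ
  rw [← hρdef] at hcp
  have := hmax τ' hopt
  linarith

end Plan

/-! ### Opposite middles and the resulting entropy inequalities -/

lemma marginal_comp_equiv {Ω α : Type*} [Fintype Ω] [DecidableEq α] {π : Ω → ℝ} (σ : Ω ≃ Ω)
    (hσ : ∀ ω, π (σ ω) = π ω) (X : Ω → α) : marginal π (X ∘ σ) = marginal π X := by
  funext y
  simp only [marginal, sum_filter]
  rw [← σ.sum_comp fun ω => if X ω = y then π ω else 0]
  exact sum_congr rfl fun ω _ => by rw [hσ, Function.comp_apply]

lemma entropy_marginal_swap {Ω α β : Type*} [Fintype Ω] [Fintype α] [Fintype β] [DecidableEq α]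
    [DecidableEq β] {π : Ω → ℝ} (hπ : ∀ ω, 0 ≤ π ω) (X : Ω → α) (Y : Ω → β) :
    entropy (marginal π fun ω => (Y ω, X ω)) = entropy (marginal π fun ω => (X ω, Y ω)) :=
  entropy_marginal_comp (fun ω => (X ω, Y ω)) (f := Prod.swap)
    (fun _ _ _ _ h => Prod.swap_injective h) hπ

section Reflection

variable {d : ℕ} {μA μB : (Fin d → Bool) → ℝ} {τ : (Fin d → Bool) → (Fin d → Bool) → ℝ}

/-- The image of `w` under the reflection of the hypercube that exchanges `a` and `b`. -/
def reflect (a b w : Fin d → Bool) : Fin d → Bool := fun i => xor (xor (a i) (b i)) (w i)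

lemma reflect_reflect (a b w : Fin d → Bool) : reflect a b (reflect a b w) = w := by
  funext i
  simp only [reflect]
  cases a i <;> cases b i <;> cases w i <;> rfl

lemma reflect_left_injective (a w : Fin d → Bool) : Function.Injective fun b => reflect a b w := by
  intro b b' h
  funext i
  have := congrFun h i
  simpa [reflect] using this

lemma reflect_right_injective (b w : Fin d → Bool) : Function.Injective fun a => reflect a b w := by
  intro a a' h
  funext i
  have := congrFun h i
  simpa [reflect] using this

lemma hammingDist_reflect_left (a b w : Fin d → Bool) :
    hammingDist a (reflect a b w) = hammingDist w b := by
  simp only [hammingDist, reflect]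
  congr 1
  refine filter_congr fun i _ => ?_
  cases a i <;> cases b i <;> cases w i <;> decide

lemma hammingDist_reflect_right (a b w : Fin d → Bool) :
    hammingDist (reflect a b w) b = hammingDist a w := by
  simp only [hammingDist, reflect]
  congr 1
  refine filter_congr fun i _ => ?_
  cases a i <;> cases b i <;> cases w i <;> decide

lemma hammingDist_reflect_reflect (a b u v : Fin d → Bool) :
    hammingDist (reflect a b v) (reflect a b u) = hammingDist u v := by
  simp only [hammingDist, reflect]
  congr 1
  refine filter_congr fun i _ => ?_
  cases a i <;> cases b i <;> cases u i <;> cases v i <;> decide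

/-- The opposite of the midpoint `c` of `a` and `b`. -/
def opposite (a b : Fin d → Bool) (c : (Fin d → Bool) × (Fin d → Bool)) :
    (Fin d → Bool) × (Fin d → Bool) :=
  (reflect a b c.2, reflect a b c.1)

lemma isMid_opposite_iff (a b : Fin d → Bool) (c : (Fin d → Bool) × (Fin d → Bool)) :
    IsMid a b (opposite a b c) ↔ IsMid a b c := by
  simp only [IsMid, opposite, hammingDist_reflect_left, hammingDist_reflect_right,
    hammingDist_reflect_reflect]
  omega

/-- The exchange of opposite midpoints. -/
def oppositeEquiv (d : ℕ) :
    ((Fin d → Bool) × (Fin d → Bool)) × ((Fin d → Bool) × (Fin d → Bool)) ≃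
      ((Fin d → Bool) × (Fin d → Bool)) × ((Fin d → Bool) × (Fin d → Bool)) :=
  Function.Involutive.toPerm (fun ω => (ω.1, opposite ω.1.1 ω.1.2 ω.2)) fun ω => by
    simp [opposite, reflect_reflect]

lemma plan_oppositeEquiv (τ : (Fin d → Bool) → (Fin d → Bool) → ℝ) (ω) :
    plan τ (oppositeEquiv d ω) = plan τ ω := by
  change τ ω.1.1 ω.1.2 * midWeight ω.1.1 ω.1.2 (opposite ω.1.1 ω.1.2 ω.2) = _
  simp only [plan, midWeight, isMid_opposite_iff]

lemma marginal_plan_ends (τ : (Fin d → Bool) → (Fin d → Bool) → ℝ) :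
    marginal (plan τ) (fun ω => ω.1) = fun e => τ e.1 e.2 := by
  funext e
  rw [marginal, sum_filter, Fintype.sum_prod_type, Fintype.sum_eq_single e fun x hx => by simp [hx]]
  simpa using sum_plan τ e.1 e.2

lemma marginal_plan_left (h : IsTransport μA μB τ) :
    marginal (plan τ) (fun ω => ω.1.1) = μA := by
  have := marginal_marginal (plan τ) (fun ω => ω.1) Prod.fst
  rw [marginal_plan_ends] at this
  refine this.symm.trans (funext fun a => ?_)
  rw [← h.sum_right a, marginal, sum_filter, Fintype.sum_prod_type,
    Fintype.sum_eq_single a fun x hx => by simp [hx]]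
  simp

lemma marginal_plan_right (h : IsTransport μA μB τ) :
    marginal (plan τ) (fun ω => ω.1.2) = μB := by
  have := marginal_marginal (plan τ) (fun ω => ω.1) Prod.snd
  rw [marginal_plan_ends] at this
  refine this.symm.trans (funext fun b => ?_)
  rw [← h.sum_left b, marginal, sum_filter, Fintype.sum_prod_type_right,
    Fintype.sum_eq_single b fun x hx => by simp [hx]]
  simp

lemma sum_plan_eq_one (h : IsTransport μA μB τ) (hA : μA ∈ stdSimplex ℝ (Fin d → Bool)) :
    ∑ ω, plan τ ω = 1 := by
  rw [← sum_marginal (plan τ) fun ω => ω.1.1, marginal_plan_left h, hA.2]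

/-- Submodularity for C and its opposite C', given A: the reflection preserves the plan, so (A,C')
is distributed as (A,C). Injectivity holds because c'.1 is the coordinatewise sum of a, b and c.2
modulo 2. -/
lemma entropy_plan_add_left_le (h : IsTransport μA μB τ) :
    entropy (plan τ) + entropy μA ≤
      2 * entropy (marginal (plan τ) fun ω => (ω.1.1, ω.2)) := by
  have hπ := plan_nonneg h.nonneg
  have h1 := submodular hπ (fun ω => ω.2) (fun ω => (oppositeEquiv d ω).2) (fun ω => ω.1.1) (by
    rintro ⟨⟨a, b⟩, c⟩ ⟨⟨a', b'⟩, c'⟩ h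
    simp only [Prod.mk.injEq] at h
    obtain ⟨rfl, h2, rfl⟩ := h
    have h3 : b = b' := reflect_left_injective a c.2 (congrArg Prod.fst h2)
    rw [h3])
  have h2 : marginal (plan τ) (fun ω => ((oppositeEquiv d ω).2, ω.1.1)) =
      marginal (plan τ) (fun ω => (ω.2, ω.1.1)) :=
    marginal_comp_equiv (oppositeEquiv d) (plan_oppositeEquiv τ) fun ω => (ω.2, ω.1.1)
  rw [h2, marginal_plan_left h, entropy_marginal_swap hπ (fun ω => ω.1.1) (fun ω => ω.2)] at h1
  linarith

lemma entropy_plan_add_right_le (h : IsTransport μA μB τ) :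
    entropy (plan τ) + entropy μB ≤
      2 * entropy (marginal (plan τ) fun ω => (ω.1.2, ω.2)) := by
  have hπ := plan_nonneg h.nonneg
  have h1 := submodular hπ (fun ω => ω.2) (fun ω => (oppositeEquiv d ω).2) (fun ω => ω.1.2) (by
    rintro ⟨⟨a, b⟩, c⟩ ⟨⟨a', b'⟩, c'⟩ h
    simp only [Prod.mk.injEq] at h
    obtain ⟨rfl, h2, rfl⟩ := h
    have h3 : a = a' := reflect_right_injective b c.2 (congrArg Prod.fst h2)
    rw [h3])
  have h2 : marginal (plan τ) (fun ω => ((oppositeEquiv d ω).2, ω.1.2)) =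
      marginal (plan τ) (fun ω => (ω.2, ω.1.2)) :=
    marginal_comp_equiv (oppositeEquiv d) (plan_oppositeEquiv τ) fun ω => (ω.2, ω.1.2)
  rw [h2, marginal_plan_right h, entropy_marginal_swap hπ (fun ω => ω.1.2) (fun ω => ω.2)] at h1
  linarith

lemma entropy_left_add_gain_le (h : IsTransport μA μB τ) :
    entropy μA + gain τ ≤ entropy (marginal (plan τ) fun ω => (ω.1.1, ω.2)) := by
  have hπ := plan_nonneg h.nonneg
  have h1 := submodular hπ (fun ω => ω.1.2) (fun ω => ω.2) (fun ω => ω.1.1) (by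
    rintro ⟨⟨a, b⟩, c⟩ ⟨⟨a', b'⟩, c'⟩ h
    simp only [Prod.mk.injEq] at h ⊢
    tauto)
  have h2 := marginal_plan_ends τ
  rw [marginal_plan_left h, entropy_marginal_swap hπ (fun ω => ω.1.1) (fun ω => ω.2),
    entropy_marginal_swap hπ (fun ω => ω.1.1) (fun ω => ω.1.2), entropy_plan] at h1
  simp only [Prod.mk.eta, h2] at h1
  linarith

lemma entropy_right_add_gain_le (h : IsTransport μA μB τ) :
    entropy μB + gain τ ≤ entropy (marginal (plan τ) fun ω => (ω.1.2, ω.2)) := by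
  have hπ := plan_nonneg h.nonneg
  have h1 := submodular hπ (fun ω => ω.1.1) (fun ω => ω.2) (fun ω => ω.1.2) (by
    rintro ⟨⟨a, b⟩, c⟩ ⟨⟨a', b'⟩, c'⟩ h
    simp only [Prod.mk.injEq] at h ⊢
    tauto)
  have h2 := marginal_plan_ends τ
  rw [marginal_plan_right h, entropy_marginal_swap hπ (fun ω => ω.1.2) (fun ω => ω.2),
    entropy_plan] at h1
  simp only [Prod.mk.eta, h2] at h1
  linarith

lemma gain_le_entropy_middle (h : IsTransport μA μB τ) (hA : μA ∈ stdSimplex ℝ (Fin d → Bool)) :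
    gain τ ≤ entropy (marginal (plan τ) fun ω => ω.2) := by
  have hπ := plan_nonneg h.nonneg
  have h1 := submodular hπ (fun ω => ω.1) (fun ω => ω.2) (fun _ => ()) (by
    rintro ⟨e, c⟩ ⟨e', c'⟩ h
    simpa using h)
  have h2 := entropy_marginal_comp (π := plan τ) (fun ω => ω.1) (f := fun e => (e, ()))
    (fun _ _ _ _ h => (Prod.mk.inj h).1) hπ
  have h3 := entropy_marginal_comp (π := plan τ) (fun ω => ω.2) (f := fun e => (e, ()))
    (fun _ _ _ _ h => (Prod.mk.inj h).1) hπ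
  simp only [Function.comp_def] at h2 h3
  rw [entropy_marginal_unit (sum_plan_eq_one h hA), h2, h3, marginal_plan_ends, entropy_plan] at h1
  linarith

/-! ### Counting the pairs of ends with a common middle -/

lemma eq_of_erase_subset {α : Type*} [DecidableEq α] {A A' : Finset α} {i : α}
    (hc : #A = #A') (h : A.erase i ⊆ A') (h' : A'.erase i ⊆ A) : A = A' := by
  by_cases hi : i ∈ A'
  · refine eq_of_subset_of_card_le (fun x hx => ?_) hc.ge
    rcases eq_or_ne x i with rfl | hxi
    · exact hi
    · exact h (mem_erase.2 ⟨hxi, hx⟩)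
  · rw [erase_eq_of_notMem hi] at h'
    exact (eq_of_subset_of_card_le h' hc.le).symm

/-- Equality in the triangle inequality holds coordinate by coordinate, so a geodesic changes no
coordinate both before and after its middle. -/
lemma IsMid.eq_or_eq {a b : Fin d → Bool} {c : (Fin d → Bool) × (Fin d → Bool)} (h : IsMid a b c)
    (i : Fin d) : a i = c.1 i ∨ b i = c.2 i := by
  have e : ∀ x y : Fin d → Bool, hammingDist x y = ∑ i, if x i ≠ y i then 1 else 0 := fun x y => by
    rw [hammingDist, card_filter]
  have h3 := h.2.2
  simp only [e] at h3
  rw [← sum_add_distrib, ← sum_add_distrib, sum_eq_sum_iff_of_le] at h3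
  · have := h3 i (mem_univ i)
    revert this
    cases a i <;> cases b i <;> cases c.1 i <;> cases c.2 i <;> decide
  · intro j _
    cases a j <;> cases b j <;> cases c.1 j <;> cases c.2 j <;> decide

/-- Let A(e) and B(e) be the sets of coordinates where the two ends of e differ from c. All these
sets have one common size, and A(e) is disjoint from B(e') for all e, e'. The union of A(e) and B(e)
therefore almost determines e; the two coordinates i and j can be dropped because i is never in a
B(e) and j never in an A(e). -/
lemma card_ends_le (c : (Fin d → Bool) × (Fin d → Bool))
    {R : Finset ((Fin d → Bool) × (Fin d → Bool))}
    (hR : ∀ e ∈ R, ∀ e' ∈ R, IsMid e.1 e'.2 c) : #R ≤ 2 ^ (d - 2) := by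
  rcases R.eq_empty_or_nonempty with rfl | ⟨e₀, h₀⟩
  · simp
  have hl : ∀ e ∈ R, hammingDist e.1 c.1 = hammingDist c.2 e₀.2 := fun e he => (hR e he e₀ h₀).1
  have hr : ∀ e ∈ R, hammingDist c.2 e.2 = hammingDist e₀.1 c.1 := fun e he =>
    (hR e₀ h₀ e he).1.symm
  rcases (hammingDist c.2 e₀.2).eq_zero_or_pos with hp | hp
  -- If the ends coincide with c, there is only one pair; the bound 1 also covers d < 2, where the
  -- exponent is truncated to 0.
  · refine (card_le_one.2 fun e he e' he' => ?_).trans Nat.one_le_two_pow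
    have h1 : ∀ e ∈ R, e = c := fun e he => by
      have h2 := hl e he
      have h3 := hr e he
      rw [hl e₀ h₀, hp, hammingDist_eq_zero] at h3
      rw [hp, hammingDist_eq_zero] at h2
      exact Prod.ext h2 h3.symm
    rw [h1 e he, h1 e' he']
  have hp' : 0 < hammingDist e₀.1 c.1 := by rwa [hl e₀ h₀]
  obtain ⟨j, hj⟩ := Function.ne_iff.1 (hammingDist_pos.1 hp)
  obtain ⟨i, hi⟩ := Function.ne_iff.1 (hammingDist_pos.1 hp')
  have hai : ∀ e ∈ R, e.2 i = c.2 i := fun e he => ((hR e₀ h₀ e he).eq_or_eq i).resolve_left hi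
  have haj : ∀ e ∈ R, e.1 j = c.1 j := fun e he =>
    ((hR e he e₀ h₀).eq_or_eq j).resolve_right fun h => hj h.symm
  have hij : i ≠ j := fun h => hj (h ▸ (hai e₀ h₀)).symm
  have hcard : #(((univ : Finset (Fin d)).erase i).erase j).powerset = 2 ^ (d - 2) := by
    rw [card_powerset, card_erase_of_mem (by simp [hij.symm]), card_erase_of_mem (mem_univ i),
      card_univ, Fintype.card_fin]
    rfl
  rw [← hcard]
  refine card_le_card_of_injOn
    (fun e => univ.filter fun x => x ≠ j ∧ x ≠ i ∧ (e.1 x ≠ c.1 x ∨ e.2 x ≠ c.2 x)) ?_ ?_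
  · intro e _
    simp only [coe_powerset, Set.mem_preimage, Set.mem_powerset_iff]
    intro x hx
    simp at hx ⊢
    tauto
  have key : ∀ e ∈ R, ∀ e' ∈ R,
      (univ.filter fun x => x ≠ j ∧ x ≠ i ∧ (e.1 x ≠ c.1 x ∨ e.2 x ≠ c.2 x)) =
        (univ.filter fun x => x ≠ j ∧ x ≠ i ∧ (e'.1 x ≠ c.1 x ∨ e'.2 x ≠ c.2 x)) →
      (univ.filter fun x => e.1 x ≠ c.1 x).erase i ⊆ (univ.filter fun x => e'.1 x ≠ c.1 x) ∧
        (univ.filter fun x => e.2 x ≠ c.2 x).erase j ⊆ univ.filter fun x => e'.2 x ≠ c.2 x := by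
    intro e he e' he' heq
    have hx : ∀ x, _ := fun x => Finset.ext_iff.1 heq x
    simp only [mem_filter, mem_univ, true_and] at hx
    constructor
    · intro x hxm
      simp only [mem_erase, mem_filter, mem_univ, true_and] at hxm ⊢
      have h1 : x ≠ j := fun h => hxm.2 (h ▸ haj e he)
      have h2 := ((hR e he e' he').eq_or_eq x).resolve_left hxm.2
      have h3 := ((hx x).1 ⟨h1, hxm.1, Or.inl hxm.2⟩).2.2
      exact h3.resolve_right fun h => h h2
    · intro x hxm
      simp only [mem_erase, mem_filter, mem_univ, true_and] at hxm ⊢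
      have h1 : x ≠ i := fun h => hxm.2 (h ▸ hai e he)
      have h2 := ((hR e' he' e he).eq_or_eq x).resolve_right hxm.2
      have h3 := ((hx x).1 ⟨hxm.1, h1, Or.inr hxm.2⟩).2.2
      exact h3.resolve_left fun h => h h2
  -- Off i, the sets A(e) and A(e') agree by `key`; having equal size they agree at i too. The same
  -- holds for B and j.
  have bool_eq : ∀ x y z : Bool, (x ≠ z ↔ y ≠ z) → x = y := by decide
  intro e he e' he' heq
  obtain ⟨k1, k2⟩ := key e he e' he' heq
  obtain ⟨k3, k4⟩ := key e' he' e he heq.symm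
  have f1 := eq_of_erase_subset ((hl e he).trans (hl e' he').symm) k1 k3
  have hr' : ∀ e ∈ R, #(univ.filter fun x => e.2 x ≠ c.2 x) = hammingDist e₀.1 c.1 :=
    fun e he => by rw [← hr e he, hammingDist_comm, hammingDist]
  have f2 := eq_of_erase_subset ((hr' e he).trans (hr' e' he').symm) k2 k4
  refine Prod.ext (funext fun x => bool_eq _ _ (c.1 x) ?_) (funext fun x => bool_eq _ _ (c.2 x) ?_)
  · simpa using Finset.ext_iff.1 f1 x
  · simpa using Finset.ext_iff.1 f2 x

lemma entropy_plan_le (h : IsOptimal (hypercube d) μA μB τ)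
    (hA : μA ∈ stdSimplex ℝ (Fin d → Bool)) (hd : 2 ≤ d) :
    entropy (plan τ) ≤ entropy (marginal (plan τ) fun ω => ω.2) + (d - 2) * Real.log 2 := by
  have h1 := entropy_le_add_log_card (plan_nonneg h.1.nonneg) (sum_plan_eq_one h.1 hA)
    (fun ω => ω.2) (K := 2 ^ (d - 2)) (by positivity) fun c => by
      have h2 : #{ω | 0 < plan τ ω ∧ ω.2 = c} ≤ #{e | 0 < plan τ (e, c)} := by
        refine card_le_card_of_injOn (fun ω => ω.1) ?_ ?_
        · rintro ⟨e, c'⟩ hω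
          simp only [coe_filter, mem_univ, true_and, Set.mem_ofPred_eq] at hω ⊢
          rw [← hω.2]
          exact hω.1
        · rintro ⟨e, c₁⟩ h₁ ⟨e', c₂⟩ h₂ he
          simp only [coe_filter, mem_univ, true_and, Set.mem_ofPred_eq] at h₁ h₂
          exact Prod.ext he (h₁.2.trans h₂.2.symm)
      have h3 := card_ends_le c (R := {e | 0 < plan τ (e, c)}) fun e he e' he' => by
        have h4 := (plan_pos_iff τ _).1 (mem_filter.1 he).2
        have h5 := (plan_pos_iff τ _).1 (mem_filter.1 he').2
        exact h.isMid_exchange h4.1 h5.1 h4.2 h5.2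
      exact_mod_cast h2.trans h3
  rwa [Real.log_pow, Nat.cast_sub hd, Nat.cast_ofNat] at h1

/-! ### From ordered middles to vertices and edges -/

lemma midpointDist_eq_marginal (τ : (Fin d → Bool) → (Fin d → Bool) → ℝ) :
    midpointDist (hypercube d) τ = marginal (plan τ) (pairToMiddle ∘ fun ω => ω.2) := by
  funext X
  rw [midpointDist, marginal, sum_filter, Fintype.sum_prod_type, Fintype.sum_prod_type]
  refine sum_congr rfl fun a _ => sum_congr rfl fun b _ => ?_
  rw [sum_geodesics_middle, mul_sum, sum_filter]
  rfl

lemma entropy_midpointDist (h : IsOptimal (hypercube d) μA μB τ) :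
    entropy (midpointDist (hypercube d) τ) = entropy (marginal (plan τ) fun ω => ω.2) := by
  rw [midpointDist_eq_marginal]
  refine entropy_marginal_comp _ (fun ω ω' hω hω' heq => ?_) (plan_nonneg h.1.nonneg)
  obtain ⟨h1, h2⟩ := (plan_pos_iff τ _).1 hω
  obtain ⟨h3, h4⟩ := (plan_pos_iff τ _).1 hω'
  simp only [pairToMiddle] at heq
  split_ifs at heq with c1 c2 c2
  · have := Sum.inl_injective heq
    exact Prod.ext this (by rw [← c1, ← c2, this])
  · rcases Sym2.eq_iff.1 (Sum.inr_injective heq) with e | e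
    · exact Prod.ext e.1 e.2
    · have : ω'.2 = ω.2.swap := Prod.ext e.2.symm e.1.symm
      exact absurd (h.not_isMid_swap h1 h3 h2 (this ▸ h4)) c1

lemma midpointDist_mem_stdSimplex (h : IsTransport μA μB τ)
    (hA : μA ∈ stdSimplex ℝ (Fin d → Bool)) :
    midpointDist (hypercube d) τ ∈
      stdSimplex ℝ ((Fin d → Bool) ⊕ Sym2 (Fin d → Bool)) := by
  rw [midpointDist_eq_marginal]
  refine ⟨fun X => marginal_nonneg (plan_nonneg h.nonneg) _ X, ?_⟩
  rw [sum_marginal, sum_plan_eq_one h hA]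

lemma exists_of_midpointDist_ne_zero (h : IsTransport μA μB τ)
    {X : (Fin d → Bool) ⊕ Sym2 (Fin d → Bool)} (hX : midpointDist (hypercube d) τ X ≠ 0) :
    ∃ a b, 0 < μA a ∧ 0 < μB b ∧ X ∈ midpoints (hypercube d) a b := by
  rw [midpointDist_eq_marginal] at hX
  obtain ⟨ω, rfl, hω⟩ :=
    exists_of_marginal_pos ((marginal_nonneg (plan_nonneg h.nonneg) _ X).lt_of_ne hX.symm)
  obtain ⟨h1, h2⟩ := (plan_pos_iff τ _).1 hω
  exact ⟨ω.1.1, ω.1.2, h1.trans_le (h.le_left _ _), h1.trans_le (h.le_right _ _),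
    pairToMiddle_mem_midpoints h2⟩

end Reflection

/-! ### Numerical estimates -/

section Estimates

/-- A lower bound for the central binomial coefficient with the right order 4^n / √n, sharp at n =
1. -/
lemma five_mul_sixteen_pow_le {n : ℕ} (hn : 1 ≤ n) :
    5 * 16 ^ n ≤ (16 * n + 4) * n.centralBinom ^ 2 := by
  induction n, hn using Nat.le_induction with
  | base => decide
  | succ n hn ih =>
    have h := Nat.succ_mul_centralBinom_succ n
    refine le_of_mul_le_mul_left ?_ (by positivity : 0 < (n + 1) ^ 2)
    calc (n + 1) ^ 2 * (5 * 16 ^ (n + 1)) = 16 * (n + 1) ^ 2 * (5 * 16 ^ n) := by ring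
      _ ≤ 16 * (n + 1) ^ 2 * ((16 * n + 4) * n.centralBinom ^ 2) := by gcongr
      _ = (16 * (n + 1) ^ 2 * (16 * n + 4)) * n.centralBinom ^ 2 := by ring
      _ ≤ ((16 * (n + 1) + 4) * (2 * (2 * n + 1)) ^ 2) * n.centralBinom ^ 2 := by
          gcongr ?_ * _
          -- The two polynomials differ by exactly 16.
          nlinarith
      _ = (16 * (n + 1) + 4) * (2 * (2 * n + 1) * n.centralBinom) ^ 2 := by ring
      _ = (n + 1) ^ 2 * ((16 * (n + 1) + 4) * (n + 1).centralBinom ^ 2) := by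
          rw [← h]
          ring

lemma centralBinom_mul_factorial_sq (p : ℕ) :
    p.centralBinom * p.factorial ^ 2 = (2 * p).factorial := by
  rw [Nat.centralBinom_eq_two_mul_choose, two_mul, sq, ← mul_assoc,
    Nat.add_choose_mul_factorial_mul_factorial]

lemma numMid_two_mul (p : ℕ) : numMid (2 * p) = p.centralBinom := by
  rw [numMid, Nat.mul_div_cancel_left p two_pos, ← centralBinom_mul_factorial_sq]
  have : (p.factorial : ℝ) ≠ 0 := Nat.cast_ne_zero.2 (Nat.factorial_ne_zero p)
  push_cast
  field_simp

lemma numMid_two_mul_add_one (p : ℕ) : numMid (2 * p + 1) = (2 * p + 1) * p.centralBinom := by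
  rw [numMid, show (2 * p + 1) / 2 = p by omega, Nat.factorial_succ,
    ← centralBinom_mul_factorial_sq]
  have : (p.factorial : ℝ) ≠ 0 := Nat.cast_ne_zero.2 (Nat.factorial_ne_zero p)
  push_cast
  field_simp

lemma four_pow_le_numMid_sq {d k : ℕ} (hd : 2 ≤ d) (hk : k ≤ d) :
    (4 : ℝ) ^ k ≤ numMid k ^ 2 * ((8 * d + 4) / 5) := by
  have hd' : (2 : ℝ) ≤ d := by exact_mod_cast hd
  have hk' : (k : ℝ) ≤ d := by exact_mod_cast hk
  have key : ∀ p : ℕ, 1 ≤ p → (5 : ℝ) * 16 ^ p ≤ (16 * p + 4) * (p.centralBinom : ℝ) ^ 2 :=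
    fun p hp => by exact_mod_cast five_mul_sixteen_pow_le hp
  obtain ⟨p, rfl | rfl⟩ := Nat.even_or_odd' k
  · rw [numMid_two_mul, pow_mul]
    rcases p.eq_zero_or_pos with rfl | hp
    · norm_num
      linarith
    · have h1 := key p hp
      push_cast at hk'
      have h2 : (p.centralBinom : ℝ) ^ 2 * (16 * p + 4) ≤ (p.centralBinom : ℝ) ^ 2 * (8 * d + 4) :=
        mul_le_mul_of_nonneg_left (by linarith) (by positivity)
      norm_num at h1 ⊢
      linarith
  · rw [numMid_two_mul_add_one, pow_succ, pow_mul]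
    rcases p.eq_zero_or_pos with rfl | hp
    · norm_num
      linarith
    · have h1 := key p hp
      push_cast at hk'
      have hp' : (1 : ℝ) ≤ p := by exact_mod_cast hp
      have h2 : (p.centralBinom : ℝ) ^ 2 * (4 * (16 * p + 4)) ≤
          (p.centralBinom : ℝ) ^ 2 * ((2 * p + 1) ^ 2 * (8 * d + 4)) :=
        mul_le_mul_of_nonneg_left (by nlinarith) (by positivity)
      norm_num at h1 ⊢
      linarith

/-- The logarithm is at least k ln 2 up to the correction, and k ≥ k²/d since k ≤ d. This
replacement brings in the quadratic cost. -/
lemma log_numMid_ge {d k : ℕ} (hd : 2 ≤ d) (hk : k ≤ d) :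
    (k : ℝ) ^ 2 / d * Real.log 2 - Real.log ((8 * d + 4) / 5) / 2 ≤ Real.log (numMid k) := by
  have hd' : (2 : ℝ) ≤ d := by exact_mod_cast hd
  have hk' : (k : ℝ) ≤ d := by exact_mod_cast hk
  have h1 := Real.log_le_log (by positivity) (four_pow_le_numMid_sq hd hk)
  rw [Real.log_mul (pow_pos (numMid_pos k) 2).ne' (by positivity), Real.log_pow, Real.log_pow,
    show (4 : ℝ) = 2 ^ 2 by norm_num, Real.log_pow] at h1
  have h2 : (k : ℝ) ^ 2 / d ≤ k := by
    rw [div_le_iff₀ (by linarith), sq]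
    gcongr
  have h3 := mul_le_mul_of_nonneg_right h2 (Real.log_nonneg one_le_two)
  push_cast at h1
  norm_num at h1 h3 ⊢
  linarith

lemma log_le_tangent {x y : ℝ} (hx : 0 < x) (hy : 0 < y) :
    Real.log x ≤ x / y - 1 + Real.log y := by
  have := Real.log_le_sub_one_of_pos (div_pos hx hy)
  rw [Real.log_div hx.ne' hy.ne'] at this
  linarith

lemma log_twentyfour_le : Real.log 24 ≤ 23 / 5 * Real.log 2 := by
  have h := Real.log_le_log (by norm_num) (by norm_num : (24 : ℝ) ^ 5 ≤ 2 ^ 23)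
  rw [Real.log_pow, Real.log_pow] at h
  push_cast at h
  linarith

/-- Here T is the cost divided by d². The bound F ≥ g suffices for T ≤ 0.568, and the bound with 3g
takes over beyond. The logarithm is replaced by a tangent line, whose base point is chosen for each
range of T. -/
lemma gain_numeric {D T g F : ℝ} (hD : 2 ≤ D) (hT : 0 ≤ T) (hT1 : T ≤ 1)
    (hg : D * T * Real.log 2 - Real.log ((8 * D + 4) / 5) / 2 ≤ g) (h0 : 0 ≤ F) (h1 : g ≤ F)
    (h2 : 3 * g - (D - 2) * Real.log 2 ≤ F) : 6 / 5 * D * T ^ 2 - 2 ≤ F := by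
  have l1 := Real.log_two_gt_d9
  have l2 := Real.log_two_lt_d9
  have hDT : 0 ≤ D * T := by positivity
  have hy : 0 < (8 * D + 4) / 5 := by linarith
  have hgl : D * T * 0.693147 ≤ D * T * Real.log 2 := by gcongr; linarith
  rcases le_total (6 / 5 * D * T ^ 2) 2 with hs | hs
  · linarith
  rcases le_total T 0.3 with hc | hc
  -- Now D T² ≥ 5/3, so (DT)² ≥ 5D/3 dominates 8D/5, and the logarithmic term becomes one in DT
  -- alone.
  · have hlog : Real.log ((8 * D + 4) / 5) ≤ 2 * Real.log (D * T + 1) := by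
      have h3 := Real.log_le_log hy (by nlinarith : (8 * D + 4) / 5 ≤ (D * T + 1) ^ 2)
      rw [Real.log_pow] at h3
      exact_mod_cast h3
    have ht := log_le_tangent (by linarith : 0 < D * T + 1) (by norm_num : (0 : ℝ) < 2 ^ 2)
    rw [Real.log_pow] at ht
    push_cast at ht
    have : D * T * T ≤ D * T * 0.3 := by gcongr
    nlinarith
  rcases le_total T 0.568 with hc' | hc'
  · have ht := log_le_tangent hy (by norm_num : (0 : ℝ) < 2 ^ 7)
    rw [Real.log_pow] at ht
    push_cast at ht
    -- The right side is concave in T, so its endpoints decide. The value 0.0065 exceeds 1/160, half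
    -- the slope in D of the tangent at 128.
    have h3 : 0.0065 ≤ 0.693147 * T - 6 / 5 * T ^ 2 := by
      nlinarith [mul_nonneg (sub_nonneg.2 hc) (sub_nonneg.2 hc')]
    have h4 := mul_le_mul_of_nonneg_left h3 (by linarith : 0 ≤ D)
    linarith
  · have ht := log_le_tangent hy (by norm_num : (0 : ℝ) < 24)
    have h24 := log_twentyfour_le
    -- Concavity again. The value 0.7939 must exceed 1/10 + ln 2: the first term is 3/2 times the
    -- slope in D of the tangent at 24, the second comes from (D-2) ln 2.
    have h3 : 0.7939 ≤ 3 * 0.693147 * T - 6 / 5 * T ^ 2 := by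
      nlinarith [mul_nonneg (sub_nonneg.2 hT1) (sub_nonneg.2 hc')]
    have h4 := mul_le_mul_of_nonneg_left h3 (by linarith : 0 ≤ D)
    have h5 : (D - 2) * Real.log 2 ≤ (D - 2) * 0.6931472 := by
      gcongr
      linarith
    linarith

end Estimates

/-! ### Assembling the inequalities -/

section Main

variable {d : ℕ} {μA μB : (Fin d → Bool) → ℝ} {τ : (Fin d → Bool) → (Fin d → Bool) → ℝ}

lemma IsTransport.sum_eq_one (h : IsTransport μA μB τ) (hA : μA ∈ stdSimplex ℝ (Fin d → Bool)) :
    ∑ e : (Fin d → Bool) × (Fin d → Bool), τ e.1 e.2 = 1 := by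
  rw [Fintype.sum_prod_type, ← hA.2]
  exact sum_congr rfl fun a _ => h.sum_right a

lemma cost_hypercube (τ : (Fin d → Bool) → (Fin d → Bool) → ℝ) :
    cost (hypercube d) τ =
      ∑ e : (Fin d → Bool) × (Fin d → Bool), τ e.1 e.2 * (hammingDist e.1 e.2 : ℝ) ^ 2 := by
  simp only [cost, dist_hypercube, Fintype.sum_prod_type]

lemma hammingDist_le_dim (a b : Fin d → Bool) : hammingDist a b ≤ d := by
  simpa using hammingDist_le_card_fintype (x := a) (y := b)

lemma cost_nonneg (h : IsTransport μA μB τ) : 0 ≤ cost (hypercube d) τ :=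
  sum_nonneg fun a _ => sum_nonneg fun b _ => mul_nonneg (h.nonneg a b) (by positivity)

lemma cost_le_sq (h : IsTransport μA μB τ) (hA : μA ∈ stdSimplex ℝ (Fin d → Bool)) :
    cost (hypercube d) τ ≤ (d : ℝ) ^ 2 := by
  rw [cost_hypercube, ← one_mul ((d : ℝ) ^ 2), ← h.sum_eq_one hA, sum_mul]
  refine sum_le_sum fun e _ => mul_le_mul_of_nonneg_left ?_ (h.nonneg _ _)
  gcongr
  exact hammingDist_le_dim _ _

lemma le_gain (h : IsTransport μA μB τ) (hA : μA ∈ stdSimplex ℝ (Fin d → Bool)) (hd : 2 ≤ d) :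
    cost (hypercube d) τ / d * Real.log 2 - Real.log ((8 * d + 4) / 5) / 2 ≤ gain τ := by
  rw [cost_hypercube, ← one_mul (Real.log ((8 * d + 4) / 5) / 2), ← h.sum_eq_one hA, sum_mul,
    sum_div, sum_mul, ← sum_sub_distrib, gain]
  refine sum_le_sum fun e _ => ?_
  have := mul_le_mul_of_nonneg_left (log_numMid_ge hd (hammingDist_le_dim e.1 e.2))
    (h.nonneg e.1 e.2)
  refine (le_of_eq ?_).trans this
  ring

lemma entropy_midpointDist_ge (hA : μA ∈ stdSimplex ℝ (Fin d → Bool)) (hd : 1 ≤ d)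
    (h : IsOptimal (hypercube d) μA μB τ)
    (hmax : ∀ τ', IsOptimal (hypercube d) μA μB τ' → entropy (plan τ') ≤ entropy (plan τ)) :
    (1 / 3) * entropy μA + (1 / 3) * entropy μB +
        (2 / (5 * (d : ℝ) ^ 3)) * cost (hypercube d) τ ^ 2 - 2 / 3 ≤
      entropy (midpointDist (hypercube d) τ) := by
  rw [entropy_midpointDist h]
  have e0 := entropy_ends_middle_le h hmax
  have e1 := entropy_plan_add_left_le h.1
  have e2 := entropy_plan_add_right_le h.1
  have e9 : 0 ≤ entropy (marginal (plan τ) fun ω => ω.2) :=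
    entropy_marginal_nonneg (plan_nonneg h.1.nonneg) (sum_plan_eq_one h.1 hA) _
  have w0 := cost_nonneg h.1
  have w1 := cost_le_sq h.1 hA
  set W := cost (hypercube d) τ
  rcases hd.eq_or_lt with rfl | hd2
  -- For d = 1 the cost term is at most 2/5 < 2/3, so H(A) + H(B) ≤ 2H(C) and H(C) ≥ 0 suffice.
  · norm_num at w1 ⊢
    nlinarith
  have e3 := entropy_left_add_gain_le h.1
  have e4 := entropy_right_add_gain_le h.1
  have e5 := gain_le_entropy_middle h.1 hA
  have e6 := entropy_plan_le h hA hd2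
  have e7 := le_gain h.1 hA hd2
  have hD : (2 : ℝ) ≤ d := by exact_mod_cast hd2
  have hD0 : (d : ℝ) ≠ 0 := by linarith
  have hDT : (d : ℝ) * (W / (d : ℝ) ^ 2) = W / d := by field_simp
  have key := gain_numeric (D := d) (T := W / (d : ℝ) ^ 2) (g := gain τ)
    (F := 3 * entropy (marginal (plan τ) fun ω => ω.2) - entropy μA - entropy μB) hD
    (by positivity) (div_le_one_of_le₀ w1 (by positivity)) (by rwa [hDT]) (by linarith)
    (by linarith) (by linarith)
  have e8 : 6 / 5 * (d : ℝ) * (W / (d : ℝ) ^ 2) ^ 2 = 3 * (2 / (5 * (d : ℝ) ^ 3) * W ^ 2) := by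
    field_simp
    ring
  linarith

end Main

end HypercubeTransport

theorem mainTheorem10 (d : ℕ) (hd : 1 ≤ d) (μA μB : (Fin d → Bool) → ℝ)
    (hA : μA ∈ stdSimplex ℝ (Fin d → Bool)) (hB : μB ∈ stdSimplex ℝ (Fin d → Bool)) :
    ∃ τ : (Fin d → Bool) → (Fin d → Bool) → ℝ,
      HypercubeTransport.IsOptimal (HypercubeTransport.hypercube d) μA μB τ ∧
      ∃ μC : (Fin d → Bool) ⊕ Sym2 (Fin d → Bool) → ℝ,
        μC = HypercubeTransport.midpointDist (HypercubeTransport.hypercube d) τ ∧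
        μC ∈ stdSimplex ℝ ((Fin d → Bool) ⊕ Sym2 (Fin d → Bool)) ∧
        (∀ X, μC X ≠ 0 → ∃ a b, 0 < μA a ∧ 0 < μB b ∧
          X ∈ HypercubeTransport.midpoints (HypercubeTransport.hypercube d) a b) ∧
        HypercubeTransport.entropy μC ≥
          (1 / 3) * HypercubeTransport.entropy μA + (1 / 3) * HypercubeTransport.entropy μB
            + (2 / (5 * (d : ℝ) ^ 3)) *
              (HypercubeTransport.wasserstein (HypercubeTransport.hypercube d) μA μB) ^ 2
            - 2 / 3 := by
  obtain ⟨τ, h, hmax⟩ := HypercubeTransport.exists_isOptimal_max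
    (G := HypercubeTransport.hypercube d) hA hB HypercubeTransport.continuous_entropy_plan
  refine ⟨τ, h, _, rfl, HypercubeTransport.midpointDist_mem_stdSimplex h.1 hA,
    fun X hX => HypercubeTransport.exists_of_midpointDist_ne_zero h.1 hX, ?_⟩
  rw [h.wasserstein_eq]
  exact HypercubeTransport.entropy_midpointDist_ge hA hd h hmax
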